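/- Theorem (pointwise bound on the scattering amplitude). Let $M>0$ and let $\hat H=-\frac{1}{2M}\nabla^2+V$ on $\mathbb R^3$, where $V:\mathbb R^3\to\mathbb R$ is a short-range potential: locally square-integrable (for example bounded) with $V(x)=O(e^{-|x|/a})$ as $|x|\to\infty$ for some $a>0$. Let $k\in\mathbb R^3\setminus\{0\}$ and $E=\frac{|k|^2}{2M}$. A continuous function $\psi:\mathbb R^3\to\mathbb C$ is said to have ingoing wave $e^{ik\cdot x}$ and outgoing amplitude $f:S^2\to\mathbb C$ if, with $r=|x|$, $$\psi(x)=e^{ik\cdot x}+\frac{e^{i|k|r}}{r}\,f\!\left(\frac{x}{r}\right)+O(r^{-2})\qquad (r\to\infty),$$ uniformly in the direction $x/r$. Such a $\psi$ is called an approximate scattering state; it is an exact scattering state if in addition $(E-\hat H)\psi=0$. Here and below, $(E-\hat H)\psi$ is taken in the sense of distributions. Let $\psi$ be an exact scattering state with ingoing wave $e^{ik\cdot x}$ and outgoing amplitude $f$, and let $\tilde\psi$ be an approximate scattering state with the same ingoing wave $e^{ik\cdot x}$ and outgoing amplitude $\tilde f$, such that $(E-\hat H)\tilde\psi$ is a locally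 integrable function. Let $p\in\mathbb R^3$ with $|p|=|k|$, and write $\hat p=p/|p|$. Then: 1. If $\xi$ is an exact scattering state with ingoing wave $e^{-ip\cdot x}$ (with any outgoing amplitude), then $$|\tilde f(\hat p)-f(\hat p)|\le\frac{M\,\|\xi\|_\infty}{\pi}\int_{\mathbb R^3}|(E-\hat H)\tilde\psi|\,dx .$$ 2. If $V$ is spherically symmetric, then also $$|\tilde f(\hat p)-f(\hat p)|\le\frac{M\,\|\psi\|_\infty}{\pi}\int_{\mathbb R^3}|(E-\hat H)\tilde\psi|\,dx .$$ Here $\|\xi\|_\infty=\sup_x|\xi(x)|$, and the integrals may be $+\infty$. -/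

import Mathlib

open MeasureTheory
open scoped ContDiff ENNReal Laplacian

/-- Physical space `ℝ³` with its Euclidean norm. -/
abbrev Space3 : Type := EuclideanSpace ℝ (Fin 3)

/-- The celestial sphere: the unit sphere of `ℝ³`. -/
abbrev CelestialSphere : Type := Metric.sphere (0 : Space3) 1

/-- A real short-range potential: locally square-integrable (for instance bounded), and
`V(x) = O(e^{-|x|/a})` at infinity for some length `a > 0`. -/
structure IsShortRange (V : Space3 → ℝ) : Prop where
  locally_sq_integrable : ∀ K : Set Space3, IsCompact K → MemLp V 2 (volume.restrict K)
  exp_decay : ∃ a : ℝ, 0 < a ∧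
    V =O[Bornology.cobounded Space3] fun x => Real.exp (-‖x‖ / a)

/-- The kinetic energy `E = |k|² / (2M)` of a particle of mass `M` and momentum `k`. -/
noncomputable def kineticEnergy (M : ℝ) (k : Space3) : ℝ := ‖k‖ ^ 2 / (2 * M)

/-- The plane wave `e^{ik·x}`. -/
noncomputable def planeWave (k x : Space3) : ℂ :=
  Complex.exp (Complex.I * ((inner ℝ k x : ℝ) : ℂ))

/-- `IsSchrodingerViolation M V E ψ g` says that `(E - H)ψ = g` in the sense of distributions on
`ℝ³`, where `H = -∇²/(2M) + V` and `g` is a locally integrable function: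
`∫ g η = ∫ ψ (E η + ∇²η/(2M) - V η)` for every smooth compactly supported `η`. -/
def IsSchrodingerViolation (M : ℝ) (V : Space3 → ℝ) (E : ℝ) (ψ g : Space3 → ℂ) : Prop :=
  LocallyIntegrable g volume ∧
    ∀ η : Space3 → ℂ, ContDiff ℝ ∞ η → HasCompactSupport η →
      ∫ x, g x * η x =
        ∫ x, ψ x * ((E : ℂ) * η x + (Δ η) x / (2 * (M : ℂ)) - (V x : ℂ) * η x)

/-- `ψ` is a (continuous) wavefunction with ingoing plane wave `e^{ik·x}` and outgoing amplitude
`f`: uniformly in the direction `n = x/r`, as `r = |x| → ∞`,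
`ψ(x) = e^{ik·x} + (e^{i|k|r} / r) f(n) + O(r⁻²)`.
This is an approximate scattering state; `ψ` need not be an eigenstate. -/
structure HasScatteringForm (k : Space3) (ψ : Space3 → ℂ) (f : CelestialSphere → ℂ) : Prop where
  continuous : Continuous ψ
  asymptotics : ∃ C r₀ : ℝ, 0 < r₀ ∧ ∀ r : ℝ, r₀ ≤ r → ∀ n : CelestialSphere,
    ‖ψ (r • (n : Space3)) - planeWave k (r • (n : Space3))
      - Complex.exp (Complex.I * ((‖k‖ * r : ℝ) : ℂ)) / (r : ℂ) * f n‖ ≤ C / r ^ 2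

/-- An exact scattering state of `H = -∇²/(2M) + V` with ingoing plane wave `e^{ik·x}` and outgoing
amplitude `f`: it has the scattering form and satisfies `(E - H)ψ = 0` with `E = |k|²/(2M)`. -/
structure IsExactScatteringState (M : ℝ) (V : Space3 → ℝ) (k : Space3)
    (ψ : Space3 → ℂ) (f : CelestialSphere → ℂ) : Prop where
  form : HasScatteringForm k ψ f
  eigenstate : IsSchrodingerViolation M V (kineticEnergy M k) ψ 0

/-- The supremum norm `‖ψ‖_∞ = sup_x |ψ(x)|`, as an extended nonnegative real. -/
noncomputable def supNorm (ψ : Space3 → ℂ) : ℝ≥0∞ := ⨆ x, ‖ψ x‖ₑ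

/-- The `L¹` norm `∫ |g|`, as an extended nonnegative real. -/
noncomputable def lOneNorm (g : Space3 → ℂ) : ℝ≥0∞ := ∫⁻ x, ‖g x‖ₑ

/-! Put `χ = ψt - ψ`, `κ = |k|` and `g = (E - H)ψt`. The common ingoing wave cancels, so `χ` is
purely outgoing with amplitude `ft - f`, and `(Δ + κ²)χ = 2M(g + Vχ)` weakly. Likewise `v = ξ -
e^{-ip·x}` is outgoing, with `(Δ + κ²)v = 2MVξ`. Since `V` is integrable and the waves are bounded,
both sources are integrable as soon as `g` is; otherwise the bound is infinite.

Two facts about outgoing solutions suffice. Reciprocity (`IsOutgoingSolution.reciprocity`): pairing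
the source of one with the field of the other is symmetric. Amplitude formula
(`IsOutgoingSolution.amplitude_eq`): `-4πF(n) = ∫ s e^{-iκn·x}`. At `κn = p` the Fourier kernel is
`ξ - v`, so with `s = 2M(g + Vχ)` reciprocity gives `-4π(ft - f) = ∫ sξ - ∫ χ·2MVξ = 2M ∫ gξ`
(`amplitude_error_eq`). This even yields the constant `M/(2π)`. For symmetric `V`, composing `ψ`
with the reflection exchanging `k` and `-p` gives an admissible `ξ` with the same sup norm.

Reciprocity is Green's identity with no flux at infinity. The fields are only continuous and their
asymptotics cannot be differentiated, so they are mollified first: derivatives fall on the kernel,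
and the radiation condition follows (`HasFarField.isSommerfeld_conv`). The Wronskian is then
`o(R⁻²)`, while the cutoff has gradient `O(R⁻¹)` on a shell of volume `O(R³)`
(`IsSommerfeld.tendsto_flux`).

The amplitude formula is reciprocity against a spherical wave centred at a distant point `Ry` and
smoothed at scale `δ`. One side samples the far field near `Ry`, the other tends to the Fourier
integral of `s`. As `s` is merely integrable, `|Ry|/|Ry - x|` cannot be dominated for each `y`;
averaging `y` over a ball about `n₀` cures this (`exists_lintegral_waveDefect_le`), and continuity
recovers the value at `n₀`. As `δ → 0`, the source of the smoothed wave tends to `-4π` times a point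
mass. -/

namespace Scattering
open Filter Topology

/-! ### The Laplacian in coordinates and Green's identities. -/

/-- The standard basis vectors of physical space. -/
noncomputable abbrev basisVec (i : Fin 3) : Space3 := EuclideanSpace.single i (1 : ℝ)

lemma norm_basisVec (i : Fin 3) : ‖basisVec i‖ = 1 := by simp [basisVec]

lemma inner_basisVec (x : Space3) (i : Fin 3) : inner ℝ x (basisVec i) = x i := by
  simp [basisVec, EuclideanSpace.inner_single_right]

lemma laplacian_eq_sum_fderiv {u : Space3 → ℂ} {x : Space3} (hu : ContDiffAt ℝ 2 u x) :
    (Δ u) x = ∑ i, fderiv ℝ (fun y => fderiv ℝ u y (basisVec i)) x (basisVec i) := by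
  rw [InnerProductSpace.laplacian_eq_iteratedFDeriv_orthonormalBasis u
    (EuclideanSpace.basisFun (Fin 3) ℝ)]
  refine Finset.sum_congr rfl fun i _ => ?_
  rw [iteratedFDeriv_two_apply]
  have h : DifferentiableAt ℝ (fderiv ℝ u) x :=
    (hu.fderiv_right (m := 1) (by norm_num)).differentiableAt (by norm_num)
  rw [fderiv_clm_apply h (differentiableAt_const _)]
  simp [basisVec]

/-- The Laplacian may be computed in any orthonormal basis: using the image under `A` of the
standard basis on the right makes both sums agree term by term. No smoothness of `u` is needed. -/
lemma laplacian_comp_isometry_add {u : Space3 → ℂ} (A : Space3 ≃ₗᵢ[ℝ] Space3) (b x : Space3) :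
    (Δ (fun y => u (A y + b))) x = (Δ u) (A x + b) := by
  rw [InnerProductSpace.laplacian_eq_iteratedFDeriv_orthonormalBasis _
    (EuclideanSpace.basisFun (Fin 3) ℝ), InnerProductSpace.laplacian_eq_iteratedFDeriv_orthonormalBasis u
    ((EuclideanSpace.basisFun (Fin 3) ℝ).map A)]
  refine Finset.sum_congr rfl fun i _ => ?_
  have h1 : (fun y => u (A y + b)) = (fun z => u (z + b)) ∘ (A.toContinuousLinearEquiv) := rfl
  rw [h1, ← iteratedFDerivWithin_univ, ← Set.preimage_univ (f := A.toContinuousLinearEquiv),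
    ContinuousLinearEquiv.iteratedFDerivWithin_comp_right _ _ uniqueDiffOn_univ (Set.mem_univ _),
    iteratedFDerivWithin_univ, iteratedFDeriv_comp_add_right]
  simp only [ContinuousMultilinearMap.compContinuousLinearMap_apply]
  congr 1
  ext j k
  fin_cases j <;> simp

lemma laplacian_comp_sub_left {u : Space3 → ℂ} (b x : Space3) :
    (Δ (fun y => u (b - y))) x = (Δ u) (b - x) := by
  have := laplacian_comp_isometry_add (u := u) (LinearIsometryEquiv.neg ℝ) b x
  simpa [neg_add_eq_sub] using this

lemma laplacian_comp_add {u : Space3 → ℂ} (b x : Space3) :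
    (Δ (fun y => u (y + b))) x = (Δ u) (x + b) := by
  simpa using laplacian_comp_isometry_add (u := u) (LinearIsometryEquiv.refl ℝ _) b x

lemma continuous_dir {u : Space3 → ℂ} (hu : ContDiff ℝ 1 u) (v : Space3) :
    Continuous fun x => fderiv ℝ u x v :=
  (hu.continuous_fderiv (by norm_num)).clm_apply continuous_const

lemma contDiff_dir {u : Space3 → ℂ} (hu : ContDiff ℝ 2 u) (v : Space3) :
    ContDiff ℝ 1 fun x => fderiv ℝ u x v :=
  (hu.fderiv_right (m := 1) (by norm_num)).clm_apply contDiff_const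

lemma laplacian_eq {u : Space3 → ℂ} (hu : ContDiff ℝ 2 u) :
    Δ u = fun x => ∑ i, fderiv ℝ (fun y => fderiv ℝ u y (basisVec i)) x (basisVec i) :=
  funext fun _ => laplacian_eq_sum_fderiv hu.contDiffAt

lemma continuous_laplacian {u : Space3 → ℂ} (hu : ContDiff ℝ 2 u) : Continuous (Δ u) := by
  rw [laplacian_eq hu]
  exact continuous_finsetSum _ fun i _ => continuous_dir (contDiff_dir hu _) _

lemma hasCompactSupport_dir {u : Space3 → ℂ} (hu : HasCompactSupport u) (v : Space3) :
    HasCompactSupport fun x => fderiv ℝ u x v :=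
  (hu.fderiv (𝕜 := ℝ)).comp_left (g := fun L : Space3 →L[ℝ] ℂ => L v) (by simp)

lemma hasCompactSupport_laplacian {u : Space3 → ℂ} (hu : ContDiff ℝ 2 u)
    (hc : HasCompactSupport u) : HasCompactSupport (Δ u) := by
  rw [laplacian_eq hu]
  have : ∀ i, HasCompactSupport
      fun x => fderiv ℝ (fun y => fderiv ℝ u y (basisVec i)) x (basisVec i) :=
    fun i => hasCompactSupport_dir (hasCompactSupport_dir hc _) _
  simp only [Fin.sum_univ_three]
  exact ((this 0).add (this 1)).add (this 2)

lemma integral_mul_dir {φ w : Space3 → ℂ} (hφ : ContDiff ℝ 1 φ) (hc : HasCompactSupport φ)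
    (hw : ContDiff ℝ 1 w) (v : Space3) :
    ∫ x, φ x * fderiv ℝ w x v = - ∫ x, fderiv ℝ φ x v * w x := by
  apply integral_mul_fderiv_eq_neg_fderiv_mul_of_integrable
  · exact ((continuous_dir hφ v).mul hw.continuous).integrable_of_hasCompactSupport
      ((hasCompactSupport_dir hc v).mul_right)
  · exact (hφ.continuous.mul (continuous_dir hw v)).integrable_of_hasCompactSupport
      (hc.mul_right)
  · exact (hφ.continuous.mul hw.continuous).integrable_of_hasCompactSupport hc.mul_right
  · exact fun x _ => hφ.differentiable (by norm_num) x
  · exact fun x _ => hw.differentiable (by norm_num) x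

/-- Green's second identity with a compactly supported weight. -/
lemma integral_weight_green {φ u v : Space3 → ℂ} (hφ : ContDiff ℝ 1 φ) (hc : HasCompactSupport φ)
    (hu : ContDiff ℝ 2 u) (hv : ContDiff ℝ 2 v) :
    ∫ x, φ x * (v x * (Δ u) x - u x * (Δ v) x) =
      - ∫ x, ∑ i, fderiv ℝ φ x (basisVec i) *
        (v x * fderiv ℝ u x (basisVec i) - u x * fderiv ℝ v x (basisVec i)) := by
  have hu1 : ContDiff ℝ 1 u := hu.of_le (by norm_num)
  have hv1 : ContDiff ℝ 1 v := hv.of_le (by norm_num)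
  set w : Fin 3 → Space3 → ℂ := fun i x =>
    v x * fderiv ℝ u x (basisVec i) - u x * fderiv ℝ v x (basisVec i) with hw
  have hwC : ∀ i, ContDiff ℝ 1 (w i) := fun i =>
    (hv1.mul (contDiff_dir hu _)).sub (hu1.mul (contDiff_dir hv _))
  have key : ∀ x, v x * (Δ u) x - u x * (Δ v) x = ∑ i, fderiv ℝ (w i) x (basisVec i) := by
    intro x
    have hd : ∀ f : Space3 → ℂ, ContDiff ℝ 1 f → DifferentiableAt ℝ f x :=
      fun f hf => hf.differentiable (by norm_num) x
    rw [laplacian_eq hu, laplacian_eq hv]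
    simp only [Finset.mul_sum, ← Finset.sum_sub_distrib]
    refine Finset.sum_congr rfl fun i _ => ?_
    have hu' := hd _ (contDiff_dir hu (basisVec i))
    have hv' := hd _ (contDiff_dir hv (basisVec i))
    simp only [hw]
    rw [fderiv_fun_sub ((hd v hv1).fun_mul hu') ((hd u hu1).fun_mul hv'),
      fderiv_fun_mul (hd v hv1) hu', fderiv_fun_mul (hd u hu1) hv']
    simp only [sub_apply, add_apply, smul_apply, smul_eq_mul]
    ring
  simp only [key, Finset.mul_sum]
  rw [integral_finsetSum, integral_finsetSum, ← Finset.sum_neg_distrib]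
  · exact Finset.sum_congr rfl fun i _ => integral_mul_dir hφ hc (hwC i) _
  · exact fun i _ => ((continuous_dir hφ _).mul (hwC i).continuous).integrable_of_hasCompactSupport
      ((hasCompactSupport_dir hc _).mul_right)
  · exact fun i _ => (hφ.continuous.mul (continuous_dir (hwC i) _)).integrable_of_hasCompactSupport
      hc.mul_right

lemma integral_laplacian_mul {u η : Space3 → ℂ} (hu : ContDiff ℝ 2 u) (hη : ContDiff ℝ 2 η)
    (hc : HasCompactSupport η) : ∫ x, (Δ u) x * η x = ∫ x, u x * (Δ η) x := by
  have hu1 : ContDiff ℝ 1 u := hu.of_le (by norm_num)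
  have hη1 : ContDiff ℝ 1 η := hη.of_le (by norm_num)
  rw [laplacian_eq hu, laplacian_eq hη]
  simp only [Finset.mul_sum, Finset.sum_mul]
  rw [integral_finsetSum, integral_finsetSum]
  · refine Finset.sum_congr rfl fun i _ => ?_
    have h1 := integral_mul_dir hη1 hc (contDiff_dir hu (basisVec i)) (basisVec i)
    have h2 := integral_mul_dir (contDiff_dir hη (basisVec i)) (hasCompactSupport_dir hc _) hu1
      (basisVec i)
    simp only [mul_comm (η _)] at h1
    rw [h1, h2, neg_neg]
    simp only [mul_comm (u _)]
  · exact fun i _ => (hu.continuous.mul (continuous_dir (contDiff_dir hη _) _)).integrable_of_hasCompactSupport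
      (hasCompactSupport_dir (hasCompactSupport_dir hc _) _).mul_left
  · exact fun i _ => ((continuous_dir (contDiff_dir hu _) _).mul hη.continuous).integrable_of_hasCompactSupport
      hc.mul_left

/-! ### Outgoing far fields, their translates and averages. -/

/-- The phase `e^{iθ}` of a real angle. -/
noncomputable def phase (θ : ℝ) : ℂ := Complex.exp (Complex.I * (θ : ℂ))

lemma norm_phase (θ : ℝ) : ‖phase θ‖ = 1 := by
  rw [phase, mul_comm]; exact Complex.norm_exp_ofReal_mul_I θ

lemma phase_add (a b : ℝ) : phase (a + b) = phase a * phase b := by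
  simp [phase, mul_add, Complex.exp_add]

lemma phase_zero : phase 0 = 1 := by simp [phase]

lemma phase_neg_mul (a : ℝ) : phase (-a) * phase a = 1 := by
  rw [← phase_add, neg_add_cancel, phase_zero]

lemma contDiff_phase {n : WithTop ℕ∞} : ContDiff ℝ n phase :=
  (contDiff_const.mul Complex.ofRealCLM.contDiff).cexp

lemma continuous_phase : Continuous phase := contDiff_phase (n := 0).continuous

lemma norm_phase_sub_phase_le (a b : ℝ) : ‖phase a - phase b‖ ≤ |a - b| := by
  have h : phase a - phase b = phase b * (phase (a - b) - 1) := by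
    rw [mul_sub, ← phase_add]; simp
  rw [h, norm_mul, norm_phase, one_mul]
  simpa [phase] using Real.norm_exp_I_mul_ofReal_sub_one_le (x := a - b)

/-- `u` is continuous and behaves like the outgoing spherical wave `e^{iκr}/r · F(x/r)` at
infinity, up to `o(1/r)` uniformly in the direction, with `F` continuous on the unit sphere. -/
structure HasFarField (κ : ℝ) (u F : Space3 → ℂ) : Prop where
  continuous : Continuous u
  continuousOn : ContinuousOn F (Metric.sphere 0 1)
  asymptotics : ∀ ε > 0, ∃ R > 0, ∀ x : Space3, R ≤ ‖x‖ →
    ‖(‖x‖ : ℂ) * u x - phase (κ * ‖x‖) * F (‖x‖⁻¹ • x)‖ ≤ ε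

lemma dirn_mem {x : Space3} (hx : 0 < ‖x‖) : ‖x‖⁻¹ • x ∈ Metric.sphere (0 : Space3) 1 := by
  simp [norm_smul, hx.ne']

lemma norm_dirn {x : Space3} (hx : 0 < ‖x‖) : ‖‖x‖⁻¹ • x‖ = 1 := by
  simpa using dirn_mem hx

lemma HasFarField.exists_amplitude_bound {κ : ℝ} {u F : Space3 → ℂ} (h : HasFarField κ u F) :
    ∃ B > 0, ∀ n ∈ Metric.sphere (0 : Space3) 1, ‖F n‖ ≤ B := by
  obtain ⟨B, hB⟩ := (isCompact_sphere (0 : Space3) 1).exists_bound_of_continuousOn h.continuousOn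
  exact ⟨max B 1, by positivity, fun n hn => (hB n hn).trans (le_max_left _ _)⟩

lemma HasFarField.exists_bound {κ : ℝ} {u F : Space3 → ℂ} (h : HasFarField κ u F) :
    ∃ B, ∀ x, ‖u x‖ ≤ B := by
  obtain ⟨B, hB, hF⟩ := h.exists_amplitude_bound
  obtain ⟨R, hR, hu⟩ := h.asymptotics 1 one_pos
  obtain ⟨B', hB'⟩ := (isCompact_closedBall (0 : Space3) (max R 1)).exists_bound_of_continuousOn
    h.continuous.continuousOn
  refine ⟨max B' (B + 1), fun x => ?_⟩
  by_cases hx : ‖x‖ ≤ max R 1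
  · exact (hB' x (by simpa using hx)).trans (le_max_left _ _)
  · push Not at hx
    have h1 : 1 < ‖x‖ := (le_max_right _ _).trans_lt hx
    have h0 : 0 < ‖x‖ := by linarith
    have h2 := hu x ((le_max_left _ _).trans hx.le)
    have h3 : ‖phase (κ * ‖x‖) * F (‖x‖⁻¹ • x)‖ ≤ B := by
      rw [norm_mul, norm_phase, one_mul]; exact hF _ (dirn_mem h0)
    have h4 : ‖(‖x‖ : ℂ) * u x‖ ≤ B + 1 := by
      have := norm_add_le ((‖x‖ : ℂ) * u x - phase (κ * ‖x‖) * F (‖x‖⁻¹ • x))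
        (phase (κ * ‖x‖) * F (‖x‖⁻¹ • x))
      rw [sub_add_cancel] at this
      linarith
    rw [norm_mul, Complex.norm_real, norm_norm] at h4
    refine le_trans ?_ (le_max_right _ _)
    nlinarith [norm_nonneg (u x)]

/-- With `c` the component of `y` along `x`, the difference of the squares of `|x + y|` and `|x| +
c` is `|y|² - c²`; divide by their sum, which is at least `|x|`. -/
lemma abs_norm_add_sub_le {x y : Space3} {ρ : ℝ} (hx : 0 < ‖x‖) (hy : ‖y‖ ≤ ρ)
    (hρ : 2 * ρ ≤ ‖x‖) :
    |‖x + y‖ - (‖x‖ + inner ℝ (‖x‖⁻¹ • x) y)| ≤ ρ ^ 2 / ‖x‖ := by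
  set c := inner ℝ (‖x‖⁻¹ • x) y with hc
  have hcy : |c| ≤ ‖y‖ := by
    have := abs_real_inner_le_norm (‖x‖⁻¹ • x) y
    rwa [norm_dirn hx, one_mul] at this
  have hxy : inner ℝ x y = ‖x‖ * c := by
    rw [hc, real_inner_smul_left, ← mul_assoc, mul_inv_cancel₀ hx.ne', one_mul]
  have hsq : ‖x + y‖ ^ 2 = ‖x‖ ^ 2 + 2 * (‖x‖ * c) + ‖y‖ ^ 2 := by
    rw [norm_add_sq_real, hxy]
  have hab := abs_le.1 hcy
  have h1 : ‖x‖ / 2 ≤ ‖x‖ + c := by linarith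
  have h2 : ‖x‖ / 2 ≤ ‖x + y‖ := by
    have := norm_sub_le (x + y) y
    rw [add_sub_cancel_right] at this
    linarith
  have h3 : (‖x + y‖ - (‖x‖ + c)) * (‖x + y‖ + (‖x‖ + c)) = ‖y‖ ^ 2 - c ^ 2 := by
    have : ‖x + y‖ * ‖x + y‖ = ‖x‖ ^ 2 + 2 * (‖x‖ * c) + ‖y‖ ^ 2 := by rw [← hsq]; ring
    nlinarith
  have h4 : |‖y‖ ^ 2 - c ^ 2| ≤ ρ ^ 2 := by
    have := norm_nonneg y
    rw [abs_le]
    constructor <;> nlinarith [sq_abs c, abs_nonneg c]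
  rw [le_div_iff₀ hx]
  calc _ ≤ |‖x + y‖ - (‖x‖ + c)| * (‖x + y‖ + (‖x‖ + c)) := by gcongr; linarith
    _ = |(‖x + y‖ - (‖x‖ + c)) * (‖x + y‖ + (‖x‖ + c))| := by
        rw [abs_mul, abs_of_pos (show 0 < ‖x + y‖ + (‖x‖ + c) by linarith)]
    _ ≤ _ := by rw [h3]; exact h4

lemma norm_dirn_sub_dirn_le {x y : Space3} (hx : 0 < ‖x‖) (hxy : 0 < ‖x + y‖) :
    ‖‖x + y‖⁻¹ • (x + y) - ‖x‖⁻¹ • x‖ ≤ 2 * ‖y‖ / ‖x‖ := by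
  have e : ‖x + y‖⁻¹ • (x + y) - ‖x‖⁻¹ • x =
      ‖x‖⁻¹ • ((‖x‖ - ‖x + y‖) • (‖x + y‖⁻¹ • (x + y)) + y) := by
    match_scalars <;> field_simp
    ring
  rw [e, norm_smul, norm_inv, norm_norm, inv_mul_eq_div]
  gcongr
  refine (norm_add_le _ _).trans ?_
  rw [norm_smul, norm_dirn hxy, mul_one, Real.norm_eq_abs, two_mul]
  gcongr
  have := abs_norm_sub_norm_le x (x + y)
  simpa using this

/-- An outgoing wave looks like a plane wave on balls of fixed radius far from the origin. -/
lemma HasFarField.translate {κ : ℝ} {u F : Space3 → ℂ} (h : HasFarField κ u F) (ρ : ℝ) {ε : ℝ}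
    (hε : 0 < ε) : ∃ R > 0, ∀ x : Space3, R ≤ ‖x‖ → ∀ y : Space3, ‖y‖ ≤ ρ →
      ‖(‖x‖ : ℂ) * u (x + y) - phase (κ * ‖x‖) * (F (‖x‖⁻¹ • x) *
        phase (κ * inner ℝ (‖x‖⁻¹ • x) y))‖ ≤ ε := by
  obtain ⟨B, hB, hF⟩ := h.exists_amplitude_bound
  obtain ⟨R₁, hR₁, hu⟩ := h.asymptotics (min 1 (ε / 4)) (by positivity)
  obtain ⟨δ, hδ, hFu⟩ := Metric.uniformContinuousOn_iff_le.1
    ((isCompact_sphere (0 : Space3) 1).uniformContinuousOn_of_continuous h.continuousOn)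
    (ε / 4) (by positivity)
  wlog hρ : 0 < ρ generalizing ρ
  · obtain ⟨R, hR, H⟩ := this 1 one_pos
    exact ⟨R, hR, fun x hx y hy => H x hx y (by linarith)⟩
  -- Apart from the first bound, which keeps `x + y` away from the origin, each lower bound on `R`
  -- controls one of four errors of size `ε / 4`: the far-field remainder, the change of direction
  -- in `F`, the change of prefactor from `|x + y|` to `|x|`, and the linearized phase.
  obtain ⟨R, hR⟩ : ∃ R, 2 * ρ + 1 ≤ R ∧ R₁ + ρ ≤ R ∧ 2 * ρ / δ ≤ R ∧
      2 * ρ * (B + 1) / (ε / 4) ≤ R ∧ B * |κ| * ρ ^ 2 / (ε / 4) ≤ R := by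
    refine ⟨max (2 * ρ + 1) (max (R₁ + ρ) (max (2 * ρ / δ) (max (2 * ρ * (B + 1) / (ε / 4))
      (B * |κ| * ρ ^ 2 / (ε / 4))))), ?_⟩
    simp only [le_max_iff, le_refl, true_or, or_true, and_self]
  obtain ⟨hR1, hR2, hR3, hR4, hR5⟩ := hR
  refine ⟨R, by linarith, fun x hxR y hy => ?_⟩
  have hx : 0 < ‖x‖ := by linarith
  have hnear : ‖x‖ - ρ ≤ ‖x + y‖ := by
    have := norm_sub_le (x + y) y
    rw [add_sub_cancel_right] at this
    linarith
  have hhalf : ‖x‖ / 2 ≤ ‖x + y‖ := by linarith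
  have hxy : 0 < ‖x + y‖ := by linarith
  set n := ‖x‖⁻¹ • x with hn
  set n' := ‖x + y‖⁻¹ • (x + y) with hn'
  set A := (‖x + y‖ : ℂ) * u (x + y) with hA
  have h1 : ‖A - phase (κ * ‖x + y‖) * F n'‖ ≤ min 1 (ε / 4) := hu _ (by linarith)
  have hFn' : ‖phase (κ * ‖x + y‖) * F n'‖ ≤ B := by
    rw [norm_mul, norm_phase, one_mul]; exact hF _ (dirn_mem hxy)
  have hAB : ‖A‖ ≤ B + 1 := by
    have := norm_add_le (A - phase (κ * ‖x + y‖) * F n') (phase (κ * ‖x + y‖) * F n')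
    rw [sub_add_cancel] at this
    have := h1.trans (min_le_left _ _)
    linarith
  have e1 : ‖(‖x‖ : ℂ) * u (x + y) - A‖ ≤ ε / 4 := by
    have : (‖x‖ : ℂ) * u (x + y) - A = (((‖x‖ - ‖x + y‖) / ‖x + y‖ : ℝ) : ℂ) * A := by
      have hne : (‖x + y‖ : ℂ) ≠ 0 := by exact_mod_cast hxy.ne'
      rw [hA]; push_cast; field_simp
    rw [this, norm_mul, Complex.norm_real, Real.norm_eq_abs, abs_div, abs_of_pos hxy]
    have h2 : |‖x‖ - ‖x + y‖| ≤ ρ := by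
      have := abs_norm_sub_norm_le x (x + y)
      simp only [sub_add_cancel_left, norm_neg] at this
      linarith
    calc |‖x‖ - ‖x + y‖| / ‖x + y‖ * ‖A‖ ≤ ρ / (‖x‖ / 2) * (B + 1) := by gcongr
      _ = 2 * ρ * (B + 1) / ‖x‖ := by field_simp
      _ ≤ ε / 4 := by
        rw [div_le_comm₀ hx (by positivity)]; linarith
  have e2 : ‖phase (κ * ‖x + y‖) * (F n' - F n)‖ ≤ ε / 4 := by
    rw [norm_mul, norm_phase, one_mul, ← dist_eq_norm]
    refine hFu _ (dirn_mem hxy) _ (dirn_mem hx) ?_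
    rw [dist_eq_norm]
    refine (norm_dirn_sub_dirn_le hx hxy).trans ?_
    rw [div_le_comm₀ hx hδ]
    refine le_trans ?_ (hR3.trans hxR)
    gcongr
  have e3 : ‖(phase (κ * ‖x + y‖) - phase (κ * (‖x‖ + inner ℝ n y))) * F n‖ ≤ ε / 4 := by
    rw [norm_mul]
    calc _ ≤ |κ * ‖x + y‖ - κ * (‖x‖ + inner ℝ n y)| * B := by
          gcongr
          · exact norm_phase_sub_phase_le _ _
          · exact hF _ (dirn_mem hx)
      _ ≤ |κ| * (ρ ^ 2 / ‖x‖) * B := by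
          rw [← mul_sub, abs_mul]
          gcongr
          exact abs_norm_add_sub_le hx hy (by linarith)
      _ = B * |κ| * ρ ^ 2 / ‖x‖ := by ring
      _ ≤ ε / 4 := by
        rw [div_le_comm₀ hx (by positivity)]; linarith
  have e : (‖x‖ : ℂ) * u (x + y) - phase (κ * ‖x‖) * (F n * phase (κ * inner ℝ n y)) =
      ((‖x‖ : ℂ) * u (x + y) - A) + (A - phase (κ * ‖x + y‖) * F n') +
      phase (κ * ‖x + y‖) * (F n' - F n) +
      (phase (κ * ‖x + y‖) - phase (κ * (‖x‖ + inner ℝ n y))) * F n := by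
    rw [mul_add κ ‖x‖, phase_add]; ring
  rw [e]
  refine (norm_add₄_le).trans ?_
  have := h1.trans (min_le_right _ _)
  linarith

/-- Translates of outgoing waves are outgoing. -/
lemma HasFarField.comp_add {κ : ℝ} {u F : Space3 → ℂ} (h : HasFarField κ u F) (y : Space3) :
    HasFarField κ (fun x => u (x + y)) (fun n => F n * phase (κ * inner ℝ n y)) where
  continuous := h.continuous.comp (continuous_id.add continuous_const)
  continuousOn := h.continuousOn.mul
    (continuous_phase.comp (by fun_prop : Continuous fun n : Space3 => κ * inner ℝ n y)).continuousOn
  asymptotics := fun ε hε => by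
    obtain ⟨R, hR, H⟩ := h.translate ‖y‖ hε
    exact ⟨R, hR, fun x hx => H x hx y le_rfl⟩

/-- Averages of an outgoing wave against a compactly supported density `w`. -/
lemma HasFarField.average {κ : ℝ} {u F : Space3 → ℂ} (h : HasFarField κ u F) {w : Space3 → ℂ}
    (hw : Continuous w) (hc : HasCompactSupport w) {ε : ℝ} (hε : 0 < ε) :
    ∃ R > 0, ∀ x : Space3, R ≤ ‖x‖ →
      ‖(‖x‖ : ℂ) * (∫ y, u (x + y) * w y) - phase (κ * ‖x‖) * (F (‖x‖⁻¹ • x) *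
        ∫ y, phase (κ * inner ℝ (‖x‖⁻¹ • x) y) * w y)‖ ≤ ε := by
  obtain ⟨ρ, hρ⟩ := hc.isCompact.isBounded.exists_norm_le
  have hwi : Integrable w := hw.integrable_of_hasCompactSupport hc
  set I := ∫ y, ‖w y‖ with hI
  have hI0 : 0 ≤ I := integral_nonneg fun _ => norm_nonneg _
  obtain ⟨R, hR, H⟩ := h.translate ρ (ε := ε / (I + 1)) (by positivity)
  refine ⟨R, hR, fun x hx => ?_⟩
  have i1 : Integrable fun y => u (x + y) * w y :=
    ((h.continuous.comp (by fun_prop)).mul hw).integrable_of_hasCompactSupport hc.mul_left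
  have i2 : Integrable fun y => phase (κ * inner ℝ (‖x‖⁻¹ • x) y) * w y :=
    ((continuous_phase.comp (by fun_prop)).mul hw).integrable_of_hasCompactSupport hc.mul_left
  have e : (‖x‖ : ℂ) * (∫ y, u (x + y) * w y) - phase (κ * ‖x‖) * (F (‖x‖⁻¹ • x) *
        ∫ y, phase (κ * inner ℝ (‖x‖⁻¹ • x) y) * w y) =
      ∫ y, ((‖x‖ : ℂ) * u (x + y) - phase (κ * ‖x‖) * (F (‖x‖⁻¹ • x) *
        phase (κ * inner ℝ (‖x‖⁻¹ • x) y))) * w y := by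
    rw [← integral_const_mul, ← integral_const_mul, ← integral_const_mul, ← integral_sub]
    · congr 1; ext y; ring
    · exact i1.const_mul _
    · exact (i2.const_mul _).const_mul _
  rw [e]
  calc _ ≤ ∫ y, ε / (I + 1) * ‖w y‖ := by
        refine norm_integral_le_of_norm_le (hwi.norm.const_mul _) (ae_of_all _ fun y => ?_)
        rw [norm_mul]
        by_cases hy : w y = 0
        · simp [hy]
        · gcongr
          exact H x hx y (hρ y (subset_tsupport _ hy))
    _ = ε / (I + 1) * I := by rw [integral_const_mul]
    _ ≤ ε := by
        rw [div_mul_eq_mul_div, div_le_iff₀ (by positivity)]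
        nlinarith

/-! ### Mollification of weak Helmholtz solutions. -/

/-- Convolution of complex functions on physical space. -/
noncomputable def conv (f w : Space3 → ℂ) : Space3 → ℂ :=
  convolution f w (ContinuousLinearMap.mul ℝ ℂ) volume

lemma conv_apply (f w : Space3 → ℂ) (x : Space3) : conv f w x = ∫ t, f t * w (x - t) := rfl

lemma conv_swap (f w : Space3 → ℂ) (x : Space3) : conv f w x = ∫ t, f (x - t) * w t :=
  convolution_eq_swap _

/-- This puts a convolution in the form handled by `HasFarField.average`, with the reflected kernel
as density. -/
lemma conv_eq_average (f w : Space3 → ℂ) (x : Space3) :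
    conv f w x = ∫ t, f (x + t) * w (-t) := by
  rw [conv_swap, ← integral_neg_eq_self]
  simp [sub_neg_eq_add]

section smoothing
variable {f w : Space3 → ℂ}

lemma contDiff_conv (hf : LocallyIntegrable f) {n : ℕ∞} (hw : ContDiff ℝ n w)
    (hc : HasCompactSupport w) : ContDiff ℝ n (conv f w) :=
  hc.contDiff_convolution_right _ hf hw

lemma fderiv_conv (hf : LocallyIntegrable f) (hw : ContDiff ℝ 1 w) (hc : HasCompactSupport w)
    (x v : Space3) : fderiv ℝ (conv f w) x v = conv f (fun y => fderiv ℝ w y v) x := by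
  rw [conv, (hc.hasFDerivAt_convolution_right _ hf hw x).fderiv,
    convolution_precompR_apply _ hf (hc.fderiv (𝕜 := ℝ)) (hw.continuous_fderiv (by norm_num))]
  rfl

lemma integrable_conv_integrand (hf : LocallyIntegrable f) (hw : Continuous w)
    (hc : HasCompactSupport w) (x : Space3) : Integrable fun t => f t * w (x - t) :=
  hc.convolutionExists_right (ContinuousLinearMap.mul ℝ ℂ) hf hw x

lemma laplacian_conv (hf : LocallyIntegrable f) (hw : ContDiff ℝ ∞ w) (hc : HasCompactSupport w)
    (x : Space3) : (Δ (conv f w)) x = conv f (Δ w) x := by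
  have hw2 : ContDiff ℝ 2 w := hw.of_le (by norm_cast)
  have hw1 : ContDiff ℝ 1 w := hw.of_le (by norm_cast)
  rw [laplacian_eq (contDiff_conv hf (n := 2) hw2 hc), laplacian_eq hw2]
  simp only [fderiv_conv hf hw1 hc]
  have h : ∀ i, fderiv ℝ (fun y => conv f (fun z => fderiv ℝ w z (basisVec i)) y) x (basisVec i) =
      conv f (fun y => fderiv ℝ (fun z => fderiv ℝ w z (basisVec i)) y (basisVec i)) x := fun i =>
    fderiv_conv hf (contDiff_dir hw2 _) (hasCompactSupport_dir hc _) x _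
  simp only [h]
  simp only [conv_apply, Finset.mul_sum]
  rw [integral_finsetSum]
  exact fun i _ => integrable_conv_integrand hf (continuous_dir (contDiff_dir hw2 _) _)
    (hasCompactSupport_dir (hasCompactSupport_dir hc _) _) x

/-- `(Δ + κ²)u = s` in the sense of distributions. -/
def IsWeakHelmholtz (κ : ℝ) (u s : Space3 → ℂ) : Prop :=
  ∀ η : Space3 → ℂ, ContDiff ℝ ∞ η → HasCompactSupport η →
    ∫ x, s x * η x = ∫ x, u x * ((Δ η) x + (κ : ℂ) ^ 2 * η x)

lemma IsWeakHelmholtz.conv {κ : ℝ} {u s : Space3 → ℂ} (h : IsWeakHelmholtz κ u s)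
    (hu : LocallyIntegrable u) (hw : ContDiff ℝ ∞ w) (hc : HasCompactSupport w) (x : Space3) :
    (Δ (conv u w)) x + (κ : ℂ) ^ 2 * conv u w x = conv s w x := by
  have hw2 : ContDiff ℝ 2 w := hw.of_le (by norm_cast)
  have hη : ContDiff ℝ ∞ fun y => w (x - y) := hw.comp (contDiff_const.sub contDiff_id)
  have hcη : HasCompactSupport fun y => w (x - y) :=
    -- The test function is the reflected kernel translated to `x`, so the weak equation evaluates
    -- the smoothed equation pointwise at `x`.
    hc.comp_homeomorph (Homeomorph.subLeft x)
  have := h _ hη hcη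
  rw [laplacian_conv hu hw hc, conv_apply s, this, conv_apply, conv_apply, ← integral_const_mul,
    ← integral_add]
  · congr 1; ext y
    rw [laplacian_comp_sub_left]; ring
  · exact integrable_conv_integrand hu (continuous_laplacian hw2) (hasCompactSupport_laplacian hw2 hc) x
  · exact (integrable_conv_integrand hu hw.continuous hc x).const_mul _

lemma integrable_conv (hf : Integrable f) (hw : Integrable w) : Integrable (conv f w) :=
  hf.integrable_convolution _ hw

/-- Fubini, with evenness of the kernel making convolution self-adjoint for the bilinear pairing. -/
lemma integral_conv_mul (hf : Integrable f) (hw : Continuous w) (hc : HasCompactSupport w)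
    (heven : ∀ x, w (-x) = w x) {v : Space3 → ℂ} (hv : Continuous v) {B : ℝ}
    (hB : ∀ x, ‖v x‖ ≤ B) : ∫ x, conv f w x * v x = ∫ x, f x * conv v w x := by
  have hwi : Integrable w := hw.integrable_of_hasCompactSupport hc
  have hint : Integrable (fun p : Space3 × Space3 => f p.2 * w (p.1 - p.2) * v p.1)
      (volume.prod volume) := by
    have h1 := hf.convolution_integrand (ContinuousLinearMap.mul ℝ ℂ) hwi
    refine h1.mul_bdd (c := B) (hv.comp continuous_fst).aestronglyMeasurable
      (ae_of_all _ fun p => hB _)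
  simp only [conv_apply, ← integral_const_mul, ← integral_mul_const]
  rw [integral_integral_swap hint]
  congr 1; ext y; congr 1; ext x
  rw [← heven (x - y), neg_sub]; ring

end smoothing

/-- The normalized smooth kernel of a bump function, as a complex function. -/
noncomputable def kernel (ρ : ContDiffBump (0 : Space3)) : Space3 → ℂ :=
  fun x => (ρ.normed volume x : ℂ)

section kernel
variable (ρ : ContDiffBump (0 : Space3))

lemma contDiff_kernel {n : ℕ∞} : ContDiff ℝ n (kernel ρ) :=
  Complex.ofRealCLM.contDiff.comp ρ.contDiff_normed

lemma hasCompactSupport_kernel : HasCompactSupport (kernel ρ) :=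
  ρ.hasCompactSupport_normed.comp_left (g := fun r : ℝ => (r : ℂ)) (by simp)

lemma kernel_neg (x : Space3) : kernel ρ (-x) = kernel ρ x := by
  simp [kernel, ρ.normed_neg]

lemma integrable_kernel : Integrable (kernel ρ) :=
  (contDiff_kernel (n := 0) ρ).continuous.integrable_of_hasCompactSupport
    (hasCompactSupport_kernel ρ)

lemma norm_conv_kernel_le {v : Space3 → ℂ} {B : ℝ} (hB : ∀ x, ‖v x‖ ≤ B) (x : Space3) :
    ‖conv v (kernel ρ) x‖ ≤ B := by
  rw [conv_swap]
  calc _ ≤ ∫ t, B * ρ.normed volume t := by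
        refine norm_integral_le_of_norm_le (ρ.integrable_normed.const_mul _) (ae_of_all _ fun t => ?_)
        rw [norm_mul, kernel, Complex.norm_real, Real.norm_of_nonneg (ρ.nonneg_normed _)]
        gcongr
        · exact ρ.nonneg_normed _
        · exact hB _
    _ = B := by rw [integral_const_mul, ρ.integral_normed, mul_one]

end kernel

lemma tendsto_conv_kernel {ρ : ℕ → ContDiffBump (0 : Space3)}
    (hρ : Tendsto (fun n => (ρ n).rOut) atTop (𝓝 0)) {v : Space3 → ℂ} (hv : Continuous v)
    (x : Space3) : Tendsto (fun n => conv v (kernel (ρ n)) x) atTop (𝓝 (v x)) := by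
  have h := ContDiffBump.convolution_tendsto_right_of_continuous (μ := volume) hρ hv x
  refine h.congr fun n => ?_
  rw [conv_swap, convolution_def]
  congr 1; ext t
  simp [kernel, mul_comm]

lemma tendsto_integral_mul_conv {ρ : ℕ → ContDiffBump (0 : Space3)}
    (hρ : Tendsto (fun n => (ρ n).rOut) atTop (𝓝 0)) {s v : Space3 → ℂ} (hs : Integrable s)
    (hv : Continuous v) {B : ℝ} (hB : ∀ x, ‖v x‖ ≤ B) :
    Tendsto (fun n => ∫ x, s x * conv v (kernel (ρ n)) x) atTop (𝓝 (∫ x, s x * v x)) := by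
  refine tendsto_integral_of_dominated_convergence (fun x => ‖s x‖ * B) (fun n => ?_)
    (hs.norm.mul_const _) (fun n => ae_of_all _ fun x => ?_) (ae_of_all _ fun x => ?_)
  · exact hs.aestronglyMeasurable.mul (contDiff_conv hv.locallyIntegrable
      (contDiff_kernel (n := 0) _) (hasCompactSupport_kernel _)).continuous.aestronglyMeasurable
  · rw [norm_mul]
    gcongr
    exact norm_conv_kernel_le _ hB x
  · exact (tendsto_conv_kernel hρ hv x).const_mul _

/-- Self-adjointness moves the mollifier from the integrable source to the bounded continuous
factor, so pointwise convergence and domination are enough and `L¹` convergence of mollified sources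
is not needed. -/
lemma tendsto_integral_conv_mul {ρ : ℕ → ContDiffBump (0 : Space3)}
    (hρ : Tendsto (fun n => (ρ n).rOut) atTop (𝓝 0)) {s v : Space3 → ℂ} (hs : Integrable s)
    (hv : Continuous v) {B : ℝ} (hB : ∀ x, ‖v x‖ ≤ B) :
    Tendsto (fun n => ∫ x, conv s (kernel (ρ n)) x * v x) atTop (𝓝 (∫ x, s x * v x)) := by
  refine (tendsto_integral_mul_conv hρ hs hv hB).congr fun n => ?_
  exact (integral_conv_mul hs (contDiff_kernel (n := 0) _).continuous (hasCompactSupport_kernel _)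
    (kernel_neg _) hv hB).symm

/-! ### The radiation condition for mollified outgoing waves. -/

/-- The Sommerfeld radiation condition for a smooth function. -/
structure IsSommerfeld (κ : ℝ) (u : Space3 → ℂ) : Prop where
  contDiff : ContDiff ℝ 2 u
  bounded : ∃ B, ∀ x, ‖u x‖ ≤ B
  decay : ∃ B > 0, ∃ R > 0, ∀ x : Space3, R ≤ ‖x‖ → ‖(‖x‖ : ℂ) * u x‖ ≤ B
  radiation : ∀ i : Fin 3, ∀ ε > 0, ∃ R > 0, ∀ x : Space3, R ≤ ‖x‖ →
    ‖(‖x‖ : ℂ) * (fderiv ℝ u x (basisVec i) -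
      Complex.I * (κ * inner ℝ (‖x‖⁻¹ • x) (basisVec i) : ℝ) * u x)‖ ≤ ε

lemma fderiv_phase_inner (κ : ℝ) (n y v : Space3) :
    fderiv ℝ (fun y => phase (κ * inner ℝ n y)) y v =
      Complex.I * (κ * inner ℝ n v : ℝ) * phase (κ * inner ℝ n y) := by
  have h : HasFDerivAt (fun y : Space3 => (κ * inner ℝ n y : ℝ)) (κ • innerSL ℝ n) y :=
    ((innerSL ℝ n).hasFDerivAt).const_mul κ
  have h2 : HasFDerivAt (fun y : Space3 => Complex.I * ((κ * inner ℝ n y : ℝ) : ℂ))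
      (Complex.I • (Complex.ofRealCLM.comp (κ • innerSL ℝ n))) y :=
    (Complex.ofRealCLM.hasFDerivAt.comp y h).const_mul Complex.I
  have h3 := h2.cexp.fderiv
  simp only [phase]
  rw [h3]
  simp
  ring

lemma contDiff_phase_inner (κ : ℝ) (m : Space3) {n : WithTop ℕ∞} :
    ContDiff ℝ n fun y : Space3 => phase (κ * inner ℝ m y) :=
  contDiff_phase.comp (contDiff_const.mul (contDiff_const.inner ℝ contDiff_id))

lemma norm_inner_dirn_basisVec_le (x : Space3) (i : Fin 3) :
    |inner ℝ (‖x‖⁻¹ • x) (basisVec i)| ≤ 1 := by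
  refine (abs_real_inner_le_norm _ _).trans ?_
  rw [norm_basisVec, mul_one, norm_smul, norm_inv, norm_norm]
  exact inv_mul_le_one

/-- Smoothing an outgoing wave produces a function with the radiation condition. -/
lemma HasFarField.isSommerfeld_conv {κ : ℝ} {u F : Space3 → ℂ} (h : HasFarField κ u F)
    (ρ : ContDiffBump (0 : Space3)) : IsSommerfeld κ (conv u (kernel ρ)) where
  contDiff := contDiff_conv h.continuous.locallyIntegrable (n := 2) (contDiff_kernel ρ)
    (hasCompactSupport_kernel ρ)
  bounded := h.exists_bound.imp fun B hB => norm_conv_kernel_le ρ hB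
  decay := by
    obtain ⟨B, hB, hF⟩ := h.exists_amplitude_bound
    obtain ⟨R, hR, H⟩ := h.average (w := fun t => kernel ρ (-t))
      ((contDiff_kernel (n := 0) ρ).continuous.comp continuous_neg)
      ((hasCompactSupport_kernel ρ).comp_homeomorph (Homeomorph.neg _)) one_pos
    set I := ∫ y, ‖kernel ρ (-y)‖
    have hI : 0 ≤ I := integral_nonneg fun _ => norm_nonneg _
    refine ⟨1 + B * I, by positivity, R, hR, fun x hx => ?_⟩
    have hx0 : 0 < ‖x‖ := hR.trans_le hx
    have h1 := H x hx
    rw [← conv_eq_average] at h1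
    set T := phase (κ * ‖x‖) * (F (‖x‖⁻¹ • x) *
      ∫ y, phase (κ * inner ℝ (‖x‖⁻¹ • x) y) * kernel ρ (-y)) with hT
    have h2 : ‖T‖ ≤ B * I := by
      rw [hT, norm_mul, norm_phase, one_mul, norm_mul]
      gcongr
      · exact hF _ (dirn_mem hx0)
      · refine (norm_integral_le_integral_norm _).trans (le_of_eq ?_)
        simp only [norm_mul, norm_phase, one_mul]; rfl
    have := norm_add_le ((‖x‖ : ℂ) * conv u (kernel ρ) x - T) T
    rw [sub_add_cancel] at this
    linarith
  radiation := by
    intro i ε hε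
    have hk1 : ContDiff ℝ 1 (kernel ρ) := contDiff_kernel (n := 1) ρ
    have hck := hasCompactSupport_kernel ρ
    obtain ⟨R₁, hR₁, H₁⟩ := h.average (w := fun t => kernel ρ (-t))
      (hk1.continuous.comp continuous_neg) (hck.comp_homeomorph (Homeomorph.neg _))
      (ε := ε / (2 * (|κ| + 1))) (by positivity)
    obtain ⟨R₂, hR₂, H₂⟩ := h.average (w := fun t => fderiv ℝ (kernel ρ) (-t) (basisVec i))
      ((continuous_dir hk1 _).comp continuous_neg)
      ((hasCompactSupport_dir hck _).comp_homeomorph (Homeomorph.neg _)) (half_pos hε)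
    refine ⟨max R₁ R₂, by positivity, fun x hx => ?_⟩
    have h1 := H₁ x ((le_max_left _ _).trans hx)
    have h2 := H₂ x ((le_max_right _ _).trans hx)
    rw [← conv_eq_average u (kernel ρ)] at h1
    rw [← conv_eq_average u (fun t => fderiv ℝ (kernel ρ) t (basisVec i)),
      ← fderiv_conv h.continuous.locallyIntegrable hk1 hck] at h2
    set n := ‖x‖⁻¹ • x with hn
    set c : ℂ := Complex.I * (κ * inner ℝ n (basisVec i) : ℝ) with hc
    have hcn : ‖c‖ ≤ |κ| := by
      rw [hc, norm_mul, Complex.norm_I, one_mul, Complex.norm_real, Real.norm_eq_abs, abs_mul]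
      exact mul_le_of_le_one_right (abs_nonneg _) (norm_inner_dirn_basisVec_le x i)
    -- Integration by parts moves the derivative from the kernel to the plane wave, where it acts as
    -- multiplication by `c`. The averages giving `∂ᵢu` and `c u` therefore have the same leading
    -- term, and only the remainders survive.
    have key : ∫ y, phase (κ * inner ℝ n y) * fderiv ℝ (kernel ρ) (-y) (basisVec i) =
        c * ∫ y, phase (κ * inner ℝ n y) * kernel ρ (-y) := by
      have hP : ContDiff ℝ 1 fun y : Space3 => phase (κ * inner ℝ (-n) y) :=
        contDiff_phase_inner κ (-n)
      have := integral_mul_dir hk1 hck hP (basisVec i)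
      simp only [fderiv_phase_inner] at this
      rw [← integral_neg_eq_self, ← integral_neg_eq_self (fun y => phase (κ * inner ℝ n y) * _)]
      simp only [neg_neg, inner_neg_right]
      simp only [inner_neg_left] at this
      have e : ∫ y, phase (κ * -inner ℝ n y) * fderiv ℝ (kernel ρ) y (basisVec i) =
          -∫ x, kernel ρ x * (Complex.I * ((κ * -inner ℝ n (basisVec i) : ℝ) : ℂ) *
            phase (κ * -inner ℝ n x)) := by
        rw [this, neg_neg]; simp only [mul_comm]
      rw [e, ← integral_neg, ← integral_const_mul]
      congr 1; ext y
      rw [hc]; push_cast; ring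
    rw [key] at h2
    set J := ∫ y, phase (κ * inner ℝ n y) * kernel ρ (-y)
    have e : (‖x‖ : ℂ) * (fderiv ℝ (conv u (kernel ρ)) x (basisVec i) - c * conv u (kernel ρ) x) =
        ((‖x‖ : ℂ) * fderiv ℝ (conv u (kernel ρ)) x (basisVec i) -
          phase (κ * ‖x‖) * (F n * (c * J))) -
        c * ((‖x‖ : ℂ) * conv u (kernel ρ) x - phase (κ * ‖x‖) * (F n * J)) := by ring
    rw [e]
    refine (norm_sub_le _ _).trans ?_
    rw [norm_mul]
    have h3 : ‖c‖ * ‖(‖x‖ : ℂ) * conv u (kernel ρ) x - phase (κ * ‖x‖) * (F n * J)‖ ≤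
        (|κ| + 1) * (ε / (2 * (|κ| + 1))) := by
      gcongr; linarith
    have h4 : (|κ| + 1) * (ε / (2 * (|κ| + 1))) = ε / 2 := by field_simp
    linarith

/-! ### Cutoffs, vanishing flux and reciprocity. -/

/-- The radial cutoff equal to `1` for `|x| ≤ 1` and to `0` for `|x| ≥ 2`. -/
noncomputable def unitCutoff : ContDiffBump (0 : Space3) := ⟨1, 2, one_pos, one_lt_two⟩

/-- The cutoff at scale `R`, as a complex function. -/
noncomputable def cutoff (R : ℝ) (x : Space3) : ℂ := (unitCutoff (R⁻¹ • x) : ℝ)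

lemma contDiff_cutoff (R : ℝ) {n : ℕ∞} : ContDiff ℝ n (cutoff R) :=
  Complex.ofRealCLM.contDiff.comp (unitCutoff.contDiff.comp (contDiff_const_smul R⁻¹))

lemma hasCompactSupport_cutoff {R : ℝ} (hR : 0 < R) : HasCompactSupport (cutoff R) := by
  have h : HasCompactSupport fun x : Space3 => unitCutoff (R⁻¹ • x) :=
    unitCutoff.hasCompactSupport.comp_smul (inv_ne_zero hR.ne')
  exact h.comp_left (g := fun r : ℝ => (r : ℂ)) (by simp)

lemma norm_cutoff_le (R : ℝ) (x : Space3) : ‖cutoff R x‖ ≤ 1 := by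
  rw [cutoff, Complex.norm_real, Real.norm_of_nonneg unitCutoff.nonneg]
  exact unitCutoff.le_one

lemma tendsto_cutoff (x : Space3) : Tendsto (fun R => cutoff R x) atTop (𝓝 1) := by
  refine tendsto_const_nhds.congr' ?_
  filter_upwards [eventually_ge_atTop (max 1 ‖x‖)] with R hR
  have h1 : 0 < R := one_pos.trans_le ((le_max_left _ _).trans hR)
  rw [cutoff, unitCutoff.one_of_mem_closedBall]
  · simp
  · simp only [unitCutoff, mem_closedBall_zero_iff, norm_smul, norm_inv, Real.norm_of_nonneg h1.le]
    rw [inv_mul_le_iff₀ h1, mul_one]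
    exact (le_max_right _ _).trans hR

lemma fderiv_cutoff (R : ℝ) (x v : Space3) :
    fderiv ℝ (cutoff R) x v = (R⁻¹ : ℝ) * fderiv ℝ (cutoff 1) (R⁻¹ • x) v := by
  have h : cutoff R = fun x => cutoff 1 (R⁻¹ • x) := by ext; simp [cutoff]
  rw [h, fderiv_comp_smul]
  simp

lemma fderiv_cutoff_eq_zero {R : ℝ} (hR : 0 < R) {x : Space3} (hx : ‖x‖ < R ∨ 2 * R < ‖x‖)
    (v : Space3) : fderiv ℝ (cutoff R) x v = 0 := by
  obtain ⟨c, hc⟩ : ∃ c : ℂ, cutoff R =ᶠ[𝓝 x] fun _ => c := by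
    rcases hx with hx | hx
    · refine ⟨1, ?_⟩
      filter_upwards [(isOpen_lt continuous_norm continuous_const).mem_nhds hx] with y hy
      rw [cutoff, unitCutoff.one_of_mem_closedBall]
      · simp
      · simp only [unitCutoff, mem_closedBall_zero_iff, norm_smul, norm_inv,
          Real.norm_of_nonneg hR.le]
        rw [inv_mul_le_iff₀ hR, mul_one]
        exact hy.le
    · refine ⟨0, ?_⟩
      filter_upwards [(isOpen_lt continuous_const continuous_norm).mem_nhds hx] with y hy
      rw [cutoff, unitCutoff.zero_of_le_dist]
      · simp
      · simp only [unitCutoff, dist_zero_right, norm_smul, norm_inv, Real.norm_of_nonneg hR.le]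
        rw [le_inv_mul_iff₀ hR]
        rw [mul_comm]; exact le_of_lt hy
  rw [hc.fderiv_eq]; simp

lemma exists_fderiv_cutoff_le : ∃ C > 0, ∀ R > 0, ∀ (x : Space3) (i : Fin 3),
    ‖fderiv ℝ (cutoff R) x (basisVec i)‖ ≤ C / R := by
  have hC1 : ContDiff ℝ 1 (cutoff 1) := contDiff_cutoff 1 (n := 1)
  obtain ⟨C, hC⟩ := (hC1.continuous_fderiv (by norm_num)).bounded_above_of_compact_support
    ((hasCompactSupport_cutoff one_pos).fderiv (𝕜 := ℝ))
  refine ⟨max C 1, by positivity, fun R hR x i => ?_⟩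
  rw [fderiv_cutoff, norm_mul, Complex.norm_real, Real.norm_of_nonneg (by positivity),
    inv_mul_eq_div]
  gcongr
  refine (ContinuousLinearMap.le_opNorm _ _).trans ?_
  rw [norm_basisVec, mul_one]
  exact (hC _).trans (le_max_left _ _)

lemma volume_real_closedBall (R : ℝ) (hR : 0 ≤ R) :
    volume.real (Metric.closedBall (0 : Space3) R) = R ^ 3 * (Real.pi * 4 / 3) := by
  rw [measureReal_def, EuclideanSpace.volume_closedBall_fin_three, ENNReal.toReal_mul,
    ENNReal.toReal_pow, ENNReal.toReal_ofReal hR, ENNReal.toReal_ofReal (by positivity)]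

/-- The radiative flux through large spheres of a pair of outgoing waves vanishes. -/
lemma IsSommerfeld.tendsto_flux {κ : ℝ} {u v : Space3 → ℂ} (hu : IsSommerfeld κ u)
    (hv : IsSommerfeld κ v) :
    Tendsto (fun R : ℝ => ∫ x, ∑ i, fderiv ℝ (cutoff R) x (basisVec i) *
      (v x * fderiv ℝ u x (basisVec i) - u x * fderiv ℝ v x (basisVec i))) atTop (𝓝 0) := by
  obtain ⟨C, hC, hφ⟩ := exists_fderiv_cutoff_le
  obtain ⟨Bu, hBu, Ru, hRu, Hu⟩ := hu.decay
  obtain ⟨Bv, hBv, Rv, hRv, Hv⟩ := hv.decay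
  rw [Metric.tendsto_atTop]
  intro ε hε
  -- Three components, gradient bound `C / R`, volume `8R³ · 4π/3` of the ball of radius `2R`, and
  -- Wronskian bound `(Bu + Bv)δ / R²`: all powers of `R` cancel. The spare factor two in `δ` gives
  -- the strict inequality.
  set K : ℝ := 3 * C * 8 * (Real.pi * 4 / 3) * (Bu + Bv) with hK
  have hK0 : 0 < K := by positivity
  set δ := ε / (2 * K) with hδ
  have hδ0 : 0 < δ := by positivity
  choose Ru' hRu' Hu' using fun i => hu.radiation i δ hδ0
  choose Rv' hRv' Hv' using fun i => hv.radiation i δ hδ0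
  set R₀ := Ru + Rv + ∑ i, Ru' i + ∑ i, Rv' i with hR₀
  have hs1 : ∀ i, Ru' i ≤ ∑ i, Ru' i := fun i =>
    Finset.single_le_sum (fun j _ => (hRu' j).le) (Finset.mem_univ i)
  have hs2 : ∀ i, Rv' i ≤ ∑ i, Rv' i := fun i =>
    Finset.single_le_sum (fun j _ => (hRv' j).le) (Finset.mem_univ i)
  have hp1 : 0 < ∑ i, Ru' i := (hRu' 0).trans_le (hs1 0)
  have hp2 : 0 < ∑ i, Rv' i := (hRv' 0).trans_le (hs2 0)
  refine ⟨R₀, fun R hR => ?_⟩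
  have hR0 : 0 < R := by linarith
  rw [dist_zero_right]
  set f : Space3 → ℂ := fun x => ∑ i, fderiv ℝ (cutoff R) x (basisVec i) *
      (v x * fderiv ℝ u x (basisVec i) - u x * fderiv ℝ v x (basisVec i)) with hf
  have hpt : ∀ x, R ≤ ‖x‖ → ∀ i,
      ‖v x * fderiv ℝ u x (basisVec i) - u x * fderiv ℝ v x (basisVec i)‖ ≤
        (Bu + Bv) * δ / R ^ 2 := by
    intro x hx i
    have hx0 : 0 < ‖x‖ := hR0.trans_le hx
    have a1 := Hu x (by linarith)
    have a2 := Hv x (by linarith)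
    have a3 := Hu' i x (by linarith [hs1 i])
    have a4 := Hv' i x (by linarith [hs2 i])
    set c : ℂ := Complex.I * (κ * inner ℝ (‖x‖⁻¹ • x) (basisVec i) : ℝ)
    -- The terms `c u v` cancel by antisymmetry, leaving only products of an `O(1)` factor with a
    -- radiation defect. This is where both waves being outgoing with the same `κ` matters.
    have e : (‖x‖ : ℂ) ^ 2 * (v x * fderiv ℝ u x (basisVec i) - u x * fderiv ℝ v x (basisVec i)) =
        ((‖x‖ : ℂ) * v x) * ((‖x‖ : ℂ) * (fderiv ℝ u x (basisVec i) - c * u x)) -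
        ((‖x‖ : ℂ) * u x) * ((‖x‖ : ℂ) * (fderiv ℝ v x (basisVec i) - c * v x)) := by ring
    have h1 : ‖x‖ ^ 2 * ‖v x * fderiv ℝ u x (basisVec i) - u x * fderiv ℝ v x (basisVec i)‖ ≤
        Bv * δ + Bu * δ := by
      calc _ = ‖(‖x‖ : ℂ) ^ 2 *
            (v x * fderiv ℝ u x (basisVec i) - u x * fderiv ℝ v x (basisVec i))‖ := by
            rw [norm_mul, norm_pow, Complex.norm_real, norm_norm]
        _ ≤ _ := by
            rw [e]
            refine (norm_sub_le _ _).trans ?_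
            rw [norm_mul, norm_mul ((‖x‖ : ℂ) * u x)]
            gcongr
    rw [le_div_iff₀ (by positivity), mul_comm]
    calc _ ≤ ‖x‖ ^ 2 * ‖v x * fderiv ℝ u x (basisVec i) - u x * fderiv ℝ v x (basisVec i)‖ := by
          gcongr
      _ ≤ _ := h1.trans (le_of_eq (by ring))
  have hbound : ∀ x, ‖f x‖ ≤ 3 * (C / R * ((Bu + Bv) * δ / R ^ 2)) := by
    intro x
    by_cases hx : R ≤ ‖x‖
    · refine (norm_sum_le _ _).trans ?_
      rw [Fin.sum_univ_three]
      have : ∀ i, ‖fderiv ℝ (cutoff R) x (basisVec i) *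
          (v x * fderiv ℝ u x (basisVec i) - u x * fderiv ℝ v x (basisVec i))‖ ≤
          C / R * ((Bu + Bv) * δ / R ^ 2) := fun i => by
        rw [norm_mul]
        gcongr
        · exact hφ R hR0 x i
        · exact hpt x hx i
      linarith [this 0, this 1, this 2]
    · push Not at hx
      simp only [hf, fderiv_cutoff_eq_zero hR0 (Or.inl hx), zero_mul, Finset.sum_const_zero,
        norm_zero]
      positivity
  have hsupp : ∫ x, f x = ∫ x in Metric.closedBall 0 (2 * R), f x := by
    refine (setIntegral_eq_integral_of_forall_compl_eq_zero fun x hx => ?_).symm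
    rw [mem_closedBall_zero_iff, not_le] at hx
    simp only [hf, fderiv_cutoff_eq_zero hR0 (Or.inr hx), zero_mul, Finset.sum_const_zero]
  rw [hsupp]
  refine (norm_setIntegral_le_of_norm_le_const (isCompact_closedBall _ _).measure_lt_top
    fun x _ => hbound x).trans_lt ?_
  rw [volume_real_closedBall _ (by positivity)]
  have : 3 * (C / R * ((Bu + Bv) * δ / R ^ 2)) * ((2 * R) ^ 3 * (Real.pi * 4 / 3)) = K * δ := by
    rw [hK]; field_simp; ring
  rw [this, hδ]
  have : K * (ε / (2 * K)) = ε / 2 := by field_simp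
  linarith

/-- Reciprocity for smooth outgoing waves. -/
lemma IsSommerfeld.reciprocity {κ : ℝ} {u v s t : Space3 → ℂ} (hu : IsSommerfeld κ u)
    (hv : IsSommerfeld κ v) (hs : Integrable s) (ht : Integrable t)
    (hus : ∀ x, (Δ u) x + (κ : ℂ) ^ 2 * u x = s x)
    (hvt : ∀ x, (Δ v) x + (κ : ℂ) ^ 2 * v x = t x) :
    ∫ x, s x * v x = ∫ x, u x * t x := by
  obtain ⟨Bu, hBu⟩ := hu.bounded
  obtain ⟨Bv, hBv⟩ := hv.bounded
  have i1 : Integrable fun x => s x * v x :=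
    hs.mul_bdd (c := Bv) hv.contDiff.continuous.aestronglyMeasurable (ae_of_all _ hBv)
  have i2 : Integrable fun x => u x * t x :=
    ht.bdd_mul (c := Bu) hu.contDiff.continuous.aestronglyMeasurable (ae_of_all _ hBu)
  have hG : ∀ x, v x * (Δ u) x - u x * (Δ v) x = s x * v x - u x * t x := fun x => by
    rw [← hus, ← hvt]; ring
  have h1 : Tendsto (fun R : ℝ => ∫ x, cutoff R x * (s x * v x - u x * t x)) atTop
      (𝓝 (∫ x, (s x * v x - u x * t x))) := by
    refine tendsto_integral_filter_of_dominated_convergence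
      (fun x => ‖s x * v x - u x * t x‖) (Eventually.of_forall fun R => ?_)
      (Eventually.of_forall fun R => ae_of_all _ fun x => ?_) (i1.sub i2).norm
      (ae_of_all _ fun x => ?_)
    · exact (contDiff_cutoff R (n := 0)).continuous.aestronglyMeasurable.mul
        (i1.sub i2).aestronglyMeasurable
    · rw [norm_mul]
      exact mul_le_of_le_one_left (norm_nonneg _) (norm_cutoff_le R x)
    · simpa using (tendsto_cutoff x).mul_const (s x * v x - u x * t x)
  have h2 := (hu.tendsto_flux hv).neg
  rw [neg_zero] at h2
  have h3 : Tendsto (fun R : ℝ => ∫ x, cutoff R x * (s x * v x - u x * t x)) atTop (𝓝 0) := by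
    refine h2.congr' ?_
    filter_upwards [eventually_gt_atTop 0] with R hR
    rw [← integral_weight_green (contDiff_cutoff R (n := 1)) (hasCompactSupport_cutoff hR)
      hu.contDiff hv.contDiff]
    simp only [hG]
  have h4 := tendsto_nhds_unique h1 h3
  rw [integral_sub i1 i2] at h4
  exact sub_eq_zero.1 h4

/-- An outgoing weak solution of `(Δ + κ²)u = s` with integrable source. -/
structure IsOutgoingSolution (κ : ℝ) (u s F : Space3 → ℂ) : Prop where
  farField : HasFarField κ u F
  integrable : Integrable s
  weak : IsWeakHelmholtz κ u s

/-- A sequence of bump functions shrinking to the origin. -/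
noncomputable def shrinkingBump (n : ℕ) : ContDiffBump (0 : Space3) :=
  ⟨1 / ((n : ℝ) + 1) / 2, 1 / ((n : ℝ) + 1), by positivity, half_lt_self (by positivity)⟩

lemma tendsto_shrinkingBump : Tendsto (fun n => (shrinkingBump n).rOut) atTop (𝓝 0) :=
  tendsto_one_div_add_atTop_nhds_zero_nat

/-- Reciprocity for outgoing weak solutions. -/
theorem IsOutgoingSolution.reciprocity {κ : ℝ} {u s F v t G : Space3 → ℂ}
    (hu : IsOutgoingSolution κ u s F) (hv : IsOutgoingSolution κ v t G) :
    ∫ x, s x * v x = ∫ x, u x * t x := by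
  have hmol : ∀ {u s F : Space3 → ℂ} (h : IsOutgoingSolution κ u s F) (n : ℕ) (x : Space3),
      (Δ (conv u (kernel (shrinkingBump n)))) x +
        (κ : ℂ) ^ 2 * conv u (kernel (shrinkingBump n)) x =
        conv s (kernel (shrinkingBump n)) x := fun h n x =>
    h.weak.conv h.farField.continuous.locallyIntegrable (contDiff_kernel (n := ⊤) _)
      (hasCompactSupport_kernel _) x
  have hint : ∀ {s : Space3 → ℂ}, Integrable s → ∀ n,
      Integrable (conv s (kernel (shrinkingBump n))) :=
    fun hs n => integrable_conv hs (integrable_kernel _)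
  obtain ⟨Bu, hBu⟩ := hu.farField.exists_bound
  obtain ⟨Bv, hBv⟩ := hv.farField.exists_bound
  -- The two solutions are mollified at independent scales: `n → ∞` with `m` fixed first, then `m →
  -- ∞`, so each limit has a single varying factor.
  have step : ∀ m, ∫ x, s x * conv v (kernel (shrinkingBump m)) x =
      ∫ x, u x * conv t (kernel (shrinkingBump m)) x := by
    intro m
    have hvm := hv.farField.isSommerfeld_conv (shrinkingBump m)
    have l1 := tendsto_integral_conv_mul tendsto_shrinkingBump hu.integrable
      hvm.contDiff.continuous (norm_conv_kernel_le (shrinkingBump m) hBv)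
    have l2 := tendsto_integral_mul_conv tendsto_shrinkingBump (hint hv.integrable m)
      hu.farField.continuous hBu
    refine tendsto_nhds_unique l1 ?_
    simp only [mul_comm (u _)]
    refine l2.congr fun n => ?_
    rw [(hu.farField.isSommerfeld_conv (shrinkingBump n)).reciprocity hvm
      (hint hu.integrable n) (hint hv.integrable m) (hmol hu n) (hmol hv m)]
    simp only [mul_comm]
  have l1 := tendsto_integral_mul_conv tendsto_shrinkingBump hu.integrable
    hv.farField.continuous hBv
  have l2 := tendsto_integral_conv_mul tendsto_shrinkingBump hv.integrable
    hu.farField.continuous hBu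
  simp only [mul_comm (u _)]
  refine tendsto_nhds_unique l1 (l2.congr fun m => ?_)
  rw [step]
  simp only [mul_comm]

/-! ### The regularized spherical wave and its concentrating source. -/

lemma contDiffAt_space_norm {x : Space3} (hx : x ≠ 0) {n : WithTop ℕ∞} :
    ContDiffAt ℝ n (fun y : Space3 => ‖y‖) x := contDiffAt_norm ℝ hx

lemma fderiv_space_norm {x : Space3} (hx : x ≠ 0) (v : Space3) :
    fderiv ℝ (fun y : Space3 => ‖y‖) x v = inner ℝ x v / ‖x‖ := by
  have h1 : HasFDerivAt (fun y : Space3 => ‖y‖) (fderiv ℝ (fun y : Space3 => ‖y‖) x) x :=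
    ((contDiffAt_space_norm hx (n := 1)).differentiableAt (by norm_num)).hasFDerivAt
  have h2 := (h1.pow 2).unique (hasStrictFDerivAt_norm_sq x).hasFDerivAt
  have h3 := congrArg (fun L : Space3 →L[ℝ] ℝ => L v) h2
  simp at h3
  rw [eq_div_iff (norm_ne_zero_iff.2 hx)]
  linarith

lemma hasFDerivAt_radial {q : ℝ → ℂ} {q₁ : ℂ} {x : Space3} (hx : x ≠ 0)
    (hq : HasDerivAt q q₁ ‖x‖) (v : Space3) :
    DifferentiableAt ℝ (fun y : Space3 => q ‖y‖) x ∧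
    fderiv ℝ (fun y : Space3 => q ‖y‖) x v = q₁ * ((inner ℝ x v / ‖x‖ : ℝ) : ℂ) := by
  have h1 : HasFDerivAt (fun y : Space3 => ‖y‖) (fderiv ℝ (fun y : Space3 => ‖y‖) x) x :=
    ((contDiffAt_space_norm hx (n := 1)).differentiableAt (by norm_num)).hasFDerivAt
  have h2 := hq.hasFDerivAt.comp x h1
  refine ⟨h2.differentiableAt, ?_⟩
  have : (fun y : Space3 => q ‖y‖) = q ∘ fun y => ‖y‖ := rfl
  rw [this, h2.fderiv, ← fderiv_space_norm hx]
  simp [mul_comm]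

/-- The Laplacian of a radial function in three dimensions. -/
lemma laplacian_radial {q q₁ q₂ : ℝ → ℂ} (h1 : ∀ r > 0, HasDerivAt q (q₁ r) r)
    (h2 : ∀ r > 0, HasDerivAt q₁ (q₂ r) r) {x : Space3} (hx : x ≠ 0)
    (hq : ContDiffAt ℝ 2 (fun y : Space3 => q ‖y‖) x) :
    (Δ fun y : Space3 => q ‖y‖) x = q₂ ‖x‖ + 2 * q₁ ‖x‖ / ‖x‖ := by
  have hr : 0 < ‖x‖ := norm_pos_iff.2 hx
  have hrc : (‖x‖ : ℂ) ≠ 0 := by exact_mod_cast hr.ne'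
  -- The `i`-th partial derivative is `p(r) xᵢ`. Differentiating again gives `p'(r) xᵢ²/r + p(r)`,
  -- whose sum is `r p' + 3p = q₂ + 2q₁/r`.
  set p : ℝ → ℂ := fun r => q₁ r / r with hp
  have hp' : HasDerivAt p ((q₂ ‖x‖ * ‖x‖ - q₁ ‖x‖ * 1) / (‖x‖ : ℂ) ^ 2) ‖x‖ :=
    (h2 _ hr).div (Complex.ofRealCLM.hasDerivAt (x := ‖x‖)) hrc
  rw [laplacian_eq_sum_fderiv hq]
  have hi : ∀ i, fderiv ℝ (fun y => fderiv ℝ (fun y : Space3 => q ‖y‖) y (basisVec i)) x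
      (basisVec i) = (q₂ ‖x‖ * ‖x‖ - q₁ ‖x‖ * 1) / (‖x‖ : ℂ) ^ 2 * ((x i) ^ 2 / ‖x‖ : ℝ) +
        q₁ ‖x‖ / ‖x‖ := by
    intro i
    have e : (fun y => fderiv ℝ (fun y : Space3 => q ‖y‖) y (basisVec i)) =ᶠ[𝓝 x]
        fun y => p ‖y‖ * ((inner ℝ y (basisVec i) : ℝ) : ℂ) := by
      filter_upwards [isOpen_ne.mem_nhds hx] with y hy
      rw [(hasFDerivAt_radial hy (h1 _ (norm_pos_iff.2 hy)) _).2, hp]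
      push_cast; ring
    rw [e.fderiv_eq]
    obtain ⟨hd, hf⟩ := hasFDerivAt_radial hx hp' (basisVec i)
    have hin : HasFDerivAt (fun y : Space3 => ((inner ℝ y (basisVec i) : ℝ) : ℂ))
        (Complex.ofRealCLM.comp (innerSL ℝ (basisVec i))) x := by
      have := Complex.ofRealCLM.hasFDerivAt.comp x (innerSL ℝ (basisVec i)).hasFDerivAt
      refine this.congr_of_eventuallyEq (Eventually.of_forall fun y => ?_)
      simp [real_inner_comm]
    rw [fderiv_fun_mul hd hin.differentiableAt, hin.fderiv]
    simp only [add_apply, smul_apply, hf, smul_eq_mul, inner_basisVec,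
      ContinuousLinearMap.comp_apply, innerSL_apply_apply]
    simp [hp]
    ring
  simp only [hi, Finset.sum_add_distrib, ← Finset.mul_sum]
  have hsum : ∑ i, (((x i) ^ 2 / ‖x‖ : ℝ) : ℂ) = ‖x‖ := by
    rw [← Complex.ofReal_sum, ← Finset.sum_div]
    have := EuclideanSpace.real_norm_sq_eq x
    rw [← this]
    congr 1; field_simp
  rw [hsum]
  simp
  field_simp
  ring

/-- A smooth step, vanishing on `(-∞, 1]` and equal to `1` on `[2, ∞)`. -/
noncomputable def step (r : ℝ) : ℝ := Real.smoothTransition (r - 1)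

lemma contDiff_step {n : ℕ∞} : ContDiff ℝ n step :=
  Real.smoothTransition.contDiff.comp (contDiff_id.sub contDiff_const)

lemma step_of_le {r : ℝ} (h : r ≤ 1) : step r = 0 :=
  Real.smoothTransition.zero_of_nonpos (by linarith)

lemma step_of_ge {r : ℝ} (h : 2 ≤ r) : step r = 1 :=
  Real.smoothTransition.one_of_one_le (by linarith)

lemma contDiff_deriv_step {n : ℕ} : ContDiff ℝ n (deriv step) := by
  have : ContDiff ℝ (n + 1) step := contDiff_step (n := ((n + 1 : ℕ) : ℕ∞))
  exact (contDiff_succ_iff_deriv.1 this).2.2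

lemma continuous_deriv2_step : Continuous (deriv (deriv step)) :=
  (contDiff_deriv_step (n := 1)).continuous_deriv (by norm_num)

lemma hasDerivAt_step (r : ℝ) : HasDerivAt step (deriv step r) r :=
  ((contDiff_step (n := 1)).differentiable (by norm_num) r).hasDerivAt

lemma hasDerivAt_deriv_step (r : ℝ) : HasDerivAt (deriv step) (deriv (deriv step) r) r :=
  ((contDiff_deriv_step (n := 1)).differentiable (by norm_num) r).hasDerivAt

lemma deriv_step_eq_zero {r : ℝ} (h : r < 1 ∨ 2 < r) : deriv step r = 0 := by
  rcases h with h | h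
  · have : step =ᶠ[𝓝 r] fun _ => 0 := by
      filter_upwards [Iio_mem_nhds h] with y hy using step_of_le (le_of_lt hy)
    rw [this.deriv_eq]; simp
  · have : step =ᶠ[𝓝 r] fun _ => 1 := by
      filter_upwards [Ioi_mem_nhds h] with y hy using step_of_ge (le_of_lt hy)
    rw [this.deriv_eq]; simp

lemma deriv2_step_eq_zero {r : ℝ} (h : r < 1 ∨ 2 < r) : deriv (deriv step) r = 0 := by
  have : deriv step =ᶠ[𝓝 r] fun _ => 0 := by
    rcases h with h | h
    · filter_upwards [Iio_mem_nhds h] with y hy using deriv_step_eq_zero (Or.inl hy)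
    · filter_upwards [Ioi_mem_nhds h] with y hy using deriv_step_eq_zero (Or.inr hy)
  rw [this.deriv_eq]; simp

lemma hasCompactSupport_of_shell {f : ℝ → ℝ} (h : ∀ r, r < 1 ∨ 2 < r → f r = 0) :
    HasCompactSupport f := by
  refine HasCompactSupport.intro (isCompact_Icc (a := (1 : ℝ)) (b := 2)) fun r hr => h r ?_
  by_contra! H
  exact hr ⟨H.1, H.2⟩

lemma exists_bound_of_shell {f : ℝ → ℝ} (hc : Continuous f)
    (h : ∀ r, r < 1 ∨ 2 < r → f r = 0) : ∃ C, ∀ r, |f r| ≤ C :=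
  hc.bounded_above_of_compact_support (hasCompactSupport_of_shell h)

/-- The outgoing spherical wave `e^{iκr}/r`, smoothly cut off at distances of order `δ` from the
origin. -/
noncomputable def sphericalWave (κ δ : ℝ) (x : Space3) : ℂ :=
  step (‖x‖ / δ) * phase (κ * ‖x‖) / ‖x‖

/-- The source `(Δ + κ²)` of the regularized spherical wave at unit scale. -/
noncomputable def unitSource (κ : ℝ) (x : Space3) : ℂ :=
  (deriv (deriv step) ‖x‖ + 2 * Complex.I * κ * deriv step ‖x‖) * phase (κ * ‖x‖) / ‖x‖

/-- The source `(Δ + κ²)` of the regularized spherical wave. -/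
noncomputable def sphericalSource (κ δ : ℝ) (x : Space3) : ℂ :=
  ((δ⁻¹ ^ 3 : ℝ) : ℂ) * unitSource (κ * δ) (δ⁻¹ • x)

lemma sphericalWave_eventually_zero {κ δ : ℝ} (hδ : 0 < δ) {x : Space3} (hx : ‖x‖ < δ) :
    sphericalWave κ δ =ᶠ[𝓝 x] fun _ => 0 := by
  filter_upwards [(isOpen_lt continuous_norm continuous_const).mem_nhds hx] with y hy
  rw [sphericalWave, step_of_le ((div_le_one hδ).2 (le_of_lt hy))]
  simp

lemma contDiff_sphericalWave (κ : ℝ) {δ : ℝ} (hδ : 0 < δ) : ContDiff ℝ 2 (sphericalWave κ δ) := by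
  rw [contDiff_iff_contDiffAt]
  intro x
  by_cases hx : x = 0
  · exact contDiffAt_const.congr_of_eventuallyEq
      (sphericalWave_eventually_zero hδ (by simpa [hx] using hδ))
  · have hn : ContDiffAt ℝ 2 (fun y : Space3 => ‖y‖) x := contDiffAt_space_norm hx
    have hof : ContDiff ℝ 2 (fun r : ℝ => (r : ℂ)) := Complex.ofRealCLM.contDiff
    have h1 : ContDiffAt ℝ 2 (fun y : Space3 => (step (‖y‖ / δ) : ℂ)) x :=
      (hof.comp (contDiff_step (n := 2))).contDiffAt.comp x (hn.div_const δ)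
    have h2 : ContDiffAt ℝ 2 (fun y : Space3 => phase (κ * ‖y‖)) x :=
      contDiff_phase.contDiffAt.comp x (contDiffAt_const.mul hn)
    have h3 : ContDiffAt ℝ 2 (fun y : Space3 => (‖y‖ : ℂ)⁻¹) x :=
      (hof.contDiffAt.comp x hn).inv (by simpa using hx)
    refine ((h1.mul h2).mul h3).congr_of_eventuallyEq (Eventually.of_forall fun y => ?_)
    rw [sphericalWave, div_eq_mul_inv]

lemma hasDerivAt_phase_mul (κ r : ℝ) :
    HasDerivAt (fun r => phase (κ * r)) (Complex.I * κ * phase (κ * r)) r := by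
  have h : HasDerivAt (fun r : ℝ => Complex.I * ((κ * r : ℝ) : ℂ)) (Complex.I * κ) r := by
    have := (Complex.ofRealCLM.hasDerivAt (x := r)).const_mul (Complex.I * κ)
    simpa [mul_assoc] using this
  have := h.cexp
  simpa [phase, mul_comm] using this

lemma laplacian_sphericalWave (κ : ℝ) {δ : ℝ} (hδ : 0 < δ) (x : Space3) :
    (Δ (sphericalWave κ δ)) x + (κ : ℂ) ^ 2 * sphericalWave κ δ x = sphericalSource κ δ x := by
  have hn : ‖δ⁻¹ • x‖ = ‖x‖ / δ := by
    rw [norm_smul, norm_inv, Real.norm_of_nonneg hδ.le, inv_mul_eq_div]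
  by_cases hx : ‖x‖ < δ
  · have h0 := sphericalWave_eventually_zero (κ := κ) hδ hx
    have h1 : ‖δ⁻¹ • x‖ < 1 := by rw [hn]; exact (div_lt_one hδ).2 hx
    rw [InnerProductSpace.laplacian_congr_nhds h0 |>.eq_of_nhds, h0.eq_of_nhds,
      sphericalSource, unitSource, deriv_step_eq_zero (Or.inl h1), deriv2_step_eq_zero (Or.inl h1)]
    simp
  · push Not at hx
    have hr : 0 < ‖x‖ := hδ.trans_le hx
    have hx0 : x ≠ 0 := norm_pos_iff.1 hr
    set a : ℝ → ℂ := fun r => step (r / δ) with ha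
    set a₁ : ℝ → ℂ := fun r => deriv step (r / δ) / δ with ha1
    set a₂ : ℝ → ℂ := fun r => deriv (deriv step) (r / δ) / δ ^ 2 with ha2
    set e : ℝ → ℂ := fun r => phase (κ * r) with he
    have hda : ∀ r, HasDerivAt a (a₁ r) r := fun r => by
      have := ((hasDerivAt_step (r / δ)).comp r ((hasDerivAt_id r).div_const δ)).ofReal_comp
      exact this.congr_deriv (by simp [ha1, div_eq_mul_inv])
    have hda1 : ∀ r, HasDerivAt a₁ (a₂ r) r := fun r => by
      have := (((hasDerivAt_deriv_step (r / δ)).comp r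
        ((hasDerivAt_id r).div_const δ)).ofReal_comp).div_const (δ : ℂ)
      exact this.congr_deriv (by simp [ha2, div_eq_mul_inv]; ring)
    have hde : ∀ r, HasDerivAt e (Complex.I * κ * e r) r := hasDerivAt_phase_mul κ
    set b : ℝ → ℂ := fun r => a r * e r with hb
    set b₁ : ℝ → ℂ := fun r => a₁ r * e r + a r * (Complex.I * κ * e r) with hb1
    set b₂ : ℝ → ℂ := fun r => (a₂ r * e r + a₁ r * (Complex.I * κ * e r)) +
      (a₁ r * (Complex.I * κ * e r) + a r * (Complex.I * κ * (Complex.I * κ * e r))) with hb2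
    have hdb : ∀ r, HasDerivAt b (b₁ r) r := fun r => (hda r).fun_mul (hde r)
    have hdb1 : ∀ r, HasDerivAt b₁ (b₂ r) r := fun r =>
      ((hda1 r).fun_mul (hde r)).fun_add ((hda r).fun_mul ((hde r).const_mul _))
    have hinv : ∀ r : ℝ, 0 < r → HasDerivAt (fun r : ℝ => (r : ℂ)⁻¹) (-1 / (r : ℂ) ^ 2) r :=
      fun r hr => by
        simpa using (Complex.ofRealCLM.hasDerivAt (x := r)).fun_inv
          (by simpa using hr.ne')
    have hq1 : ∀ r > 0, HasDerivAt (fun r : ℝ => b r / r) (b₁ r / r - b r / r ^ 2) r :=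
      fun r hr => by
        simp only [div_eq_mul_inv]
        exact ((hdb r).fun_mul (hinv r hr)).congr_deriv (by ring)
    have hq2 : ∀ r : ℝ, r > 0 → HasDerivAt (fun r : ℝ => b₁ r / r - b r / r ^ 2)
        (b₂ r / r - 2 * b₁ r / r ^ 2 + 2 * b r / r ^ 3) r := fun r hr => by
      simp only [div_eq_mul_inv, ← inv_pow]
      exact (((hdb1 r).fun_mul (hinv r hr)).fun_sub
        ((hdb r).fun_mul ((hinv r hr).fun_pow 2))).congr_deriv (by
          simp only [div_eq_mul_inv]; push_cast; ring)
    have hw : sphericalWave κ δ = fun y : Space3 => (fun r : ℝ => b r / r) ‖y‖ := by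
      ext y; simp [sphericalWave, hb, ha, he]
    have hL := laplacian_radial hq1 hq2 hx0
      (by rw [← hw]; exact (contDiff_sphericalWave κ hδ).contDiffAt)
    rw [hw, hL]
    have hrc : (‖x‖ : ℂ) ≠ 0 := by exact_mod_cast hr.ne'
    have hdc : (δ : ℂ) ≠ 0 := by exact_mod_cast hδ.ne'
    have hph : phase (κ * δ * (‖x‖ / δ)) = e ‖x‖ := by
      rw [he]; congr 1; field_simp
    rw [sphericalSource, unitSource, hn, hph]
    simp only [hb, hb1, hb2, ha, ha1, ha2]
    push_cast
    field_simp
    ring_nf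
    simp only [Complex.I_sq]
    ring

lemma unitSource_eq_zero (κ : ℝ) {z : Space3} (hz : ‖z‖ < 1 ∨ 2 < ‖z‖) : unitSource κ z = 0 := by
  rw [unitSource, deriv_step_eq_zero hz, deriv2_step_eq_zero hz]; simp

lemma sphericalSource_one (κ : ℝ) : sphericalSource κ 1 = unitSource κ := by
  ext x; simp [sphericalSource]

lemma continuous_sphericalSource (κ : ℝ) {δ : ℝ} (hδ : 0 < δ) :
    Continuous (sphericalSource κ δ) := by
  have h := contDiff_sphericalWave κ hδ
  exact ((continuous_laplacian h).add (continuous_const.mul h.continuous)).congr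
    (laplacian_sphericalWave κ hδ)

lemma hasCompactSupport_sphericalSource (κ : ℝ) {δ : ℝ} (hδ : 0 < δ) :
    HasCompactSupport (sphericalSource κ δ) := by
  refine HasCompactSupport.intro (isCompact_closedBall (0 : Space3) (2 * δ)) fun x hx => ?_
  rw [mem_closedBall_zero_iff, not_le] at hx
  rw [sphericalSource, unitSource_eq_zero, mul_zero]
  right
  rw [norm_smul, norm_inv, Real.norm_of_nonneg hδ.le, inv_mul_eq_div, lt_div_iff₀ hδ]
  exact hx

/-- Supplies the dominating function when the rescaled frequency `κδ` varies, hence the uniformity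
over `|κ| ≤ K`. The source lives on `1 ≤ |z| ≤ 2`, where dividing by `|z|` does no harm. -/
lemma exists_unitSource_bound (K : ℝ) : ∃ C, ∀ κ, |κ| ≤ K → ∀ z, ‖unitSource κ z‖ ≤
    (Metric.closedBall (0 : Space3) 2).indicator (fun _ => C) z := by
  obtain ⟨C₁, h1⟩ := exists_bound_of_shell (contDiff_deriv_step (n := 0)).continuous
    fun _ => deriv_step_eq_zero
  obtain ⟨C₂, h2⟩ := exists_bound_of_shell continuous_deriv2_step fun _ => deriv2_step_eq_zero
  refine ⟨C₂ + 2 * K * C₁, fun κ hκ z => ?_⟩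
  have hC1 : 0 ≤ C₁ := (abs_nonneg _).trans (h1 0)
  have hC2 : 0 ≤ C₂ := (abs_nonneg _).trans (h2 0)
  have hK : 0 ≤ K := (abs_nonneg _).trans hκ
  by_cases hz : ‖z‖ < 1 ∨ 2 < ‖z‖
  · rw [unitSource_eq_zero κ hz, norm_zero]
    exact Set.indicator_nonneg (fun _ _ => by positivity) _
  · push Not at hz
    rw [Set.indicator_of_mem (by simpa using hz.2), unitSource, norm_div, norm_mul, norm_phase,
      mul_one, Complex.norm_real, norm_norm]
    refine (div_le_self (norm_nonneg _) hz.1).trans ((norm_add_le _ _).trans ?_)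
    rw [norm_mul, norm_mul, norm_mul, Complex.norm_I, Complex.norm_real, Complex.norm_real,
      Complex.norm_real, Complex.norm_ofNat, mul_one]
    gcongr
    · exact h2 _
    · exact hκ
    · exact h1 _

/-- In polar coordinates the integral is `4π ∫ r step''(r) dr`, and `r step' - step` is an
antiderivative running from `0` to `-1`. -/
lemma integral_deriv2_step_div_norm :
    ∫ z : Space3, ((deriv (deriv step) ‖z‖ / ‖z‖ : ℝ) : ℂ) = -(4 * Real.pi : ℝ) := by
  rw [integral_complex_ofReal]
  have h := integral_fun_norm_addHaar (volume : Measure Space3) fun r => deriv (deriv step) r / r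
  rw [h, finrank_euclideanSpace_fin]
  have hI : ∫ y in Set.Ioi (0 : ℝ), y ^ (3 - 1) • (deriv (deriv step) y / y) = -1 := by
    have e : ∫ y in Set.Ioi (0 : ℝ), y ^ (3 - 1) • (deriv (deriv step) y / y) =
        ∫ y in Set.Ioi (0 : ℝ), y * deriv (deriv step) y := by
      refine setIntegral_congr_fun measurableSet_Ioi fun y hy => ?_
      have : y ≠ 0 := ne_of_gt hy
      simp only [smul_eq_mul]; field_simp; norm_num; ring
    rw [e]
    have hd : ∀ y ∈ Set.Ici (0 : ℝ), HasDerivAt (fun y => y * deriv step y - step y)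
        (y * deriv (deriv step) y) y := fun y _ => by
      have := ((hasDerivAt_id y).fun_mul (hasDerivAt_deriv_step y)).fun_sub (hasDerivAt_step y)
      exact this.congr_deriv (by simp)
    have hint : Integrable fun y => y * deriv (deriv step) y :=
      (continuous_id.mul continuous_deriv2_step).integrable_of_hasCompactSupport
        (hasCompactSupport_of_shell fun _ => deriv2_step_eq_zero).mul_left
    rw [integral_Ioi_of_hasDerivAt_of_tendsto' (m := -1) hd hint.integrableOn]
    · simp [step_of_le]
    · refine tendsto_const_nhds.congr' ?_
      filter_upwards [eventually_gt_atTop 2] with y hy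
      rw [deriv_step_eq_zero (Or.inr hy), step_of_ge hy.le]; simp
  rw [hI]
  have hv : volume.real (Metric.ball (0 : Space3) 1) = Real.pi * 4 / 3 := by
    rw [measureReal_def, EuclideanSpace.volume_ball_fin_three, ENNReal.toReal_mul]
    simp [ENNReal.toReal_ofReal (show 0 ≤ Real.pi * 4 / 3 by positivity)]
  rw [hv]
  simp
  ring

/-- The Fourier integral `∫ s(x) e^{iκ m·x} dx`. -/
noncomputable def transform (κ : ℝ) (s : Space3 → ℂ) (m : Space3) : ℂ :=
  ∫ x, s x * phase (κ * inner ℝ m x)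

lemma continuous_transform (κ : ℝ) {s : Space3 → ℂ} (hs : Integrable s) :
    Continuous (transform κ s) := by
  refine continuous_of_dominated (bound := fun x => ‖s x‖) (fun m => ?_) (fun m => ?_) hs.norm ?_
  · exact hs.aestronglyMeasurable.mul
      (contDiff_phase_inner κ m (n := 0)).continuous.aestronglyMeasurable
  · exact ae_of_all _ fun x => by rw [norm_mul, norm_phase, mul_one]
  · exact ae_of_all _ fun x => continuous_const.mul (continuous_phase.comp (by fun_prop))

/-- The regularized spherical wave has a source of total strength `-4π`, concentrating at the
origin. -/
lemma tendsto_transform_sphericalSource (κ : ℝ) (m : Space3) :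
    Tendsto (fun δ => transform κ (sphericalSource κ δ) m) (𝓝[>] 0)
      (𝓝 (-(4 * Real.pi : ℝ))) := by
  obtain ⟨C, hC⟩ := exists_unitSource_bound |κ|
  rw [← integral_deriv2_step_div_norm]
  -- The substitution `x = δz` absorbs the factor `δ⁻³` and replaces `κ` by `κδ`. In the limit the
  -- phases become `1` and the first-derivative term of the source drops out.
  have e : ∀ δ > 0, ∫ z, unitSource (κ * δ) z * phase (κ * δ * inner ℝ m z) =
      transform κ (sphericalSource κ δ) m := by
    intro δ hδ
    have := Measure.integral_comp_inv_smul_of_nonneg (volume : Measure Space3)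
      (fun z => unitSource (κ * δ) z * phase (κ * δ * inner ℝ m z)) hδ.le
    rw [finrank_euclideanSpace_fin] at this
    have hne : (δ : ℂ) ≠ 0 := by exact_mod_cast hδ.ne'
    have hx : ∀ x : Space3, κ * δ * inner ℝ m (δ⁻¹ • x) = κ * inner ℝ m x := fun x => by
      rw [real_inner_smul_right]; field_simp
    simp only [hx] at this
    simp only [transform, sphericalSource, mul_assoc _ (unitSource _ _)]
    rw [integral_const_mul, this, Complex.real_smul]
    push_cast
    field_simp
  have hlim : Tendsto (fun δ : ℝ => ∫ z, unitSource (κ * δ) z * phase (κ * δ * inner ℝ m z))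
      (𝓝[>] 0) (𝓝 (∫ z : Space3, ((deriv (deriv step) ‖z‖ / ‖z‖ : ℝ) : ℂ))) := by
    refine tendsto_integral_filter_of_dominated_convergence
      ((Metric.closedBall (0 : Space3) 2).indicator fun _ => C) ?_ ?_ ?_ ?_
    · refine Eventually.of_forall fun δ => ?_
      have h1 : Continuous (unitSource (κ * δ)) := by
        rw [← sphericalSource_one]; exact continuous_sphericalSource _ one_pos
      exact (h1.mul (contDiff_phase_inner (κ * δ) m (n := 0)).continuous).aestronglyMeasurable
    · filter_upwards [Ioc_mem_nhdsGT (zero_lt_one' ℝ)] with δ hδ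
      refine ae_of_all _ fun z => ?_
      rw [norm_mul, norm_phase, mul_one]
      refine hC _ ?_ z
      rw [abs_mul, abs_of_pos hδ.1]
      exact mul_le_of_le_one_right (abs_nonneg _) hδ.2
    · rw [integrable_indicator_iff measurableSet_closedBall]
      exact integrableOn_const (isCompact_closedBall _ _).measure_lt_top.ne
    · refine ae_of_all _ fun z => ?_
      have hc : Continuous fun δ : ℝ => unitSource (κ * δ) z * phase (κ * δ * inner ℝ m z) := by
        simp only [unitSource]
        have h1 : Continuous fun δ : ℝ => phase (κ * δ * ‖z‖) := continuous_phase.comp (by fun_prop)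
        have h2 : Continuous fun δ : ℝ => phase (κ * δ * inner ℝ m z) :=
          continuous_phase.comp (by fun_prop)
        fun_prop
      have := (hc.tendsto 0).mono_left (nhdsWithin_le_nhds (s := Set.Ioi 0))
      refine this.trans (le_of_eq ?_)
      simp [unitSource, phase_zero]
  refine hlim.congr' ?_
  filter_upwards [self_mem_nhdsWithin] with δ hδ using e δ hδ

/-- Beyond `2δ` the smooth step equals one and the far-field error is exactly zero; the weak
equation follows by integrating the pointwise one by parts. -/
lemma isOutgoingSolution_sphericalWave (κ : ℝ) {δ : ℝ} (hδ : 0 < δ) :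
    IsOutgoingSolution κ (sphericalWave κ δ) (sphericalSource κ δ) fun _ => 1 where
  farField :=
    { continuous := (contDiff_sphericalWave κ hδ).continuous
      continuousOn := continuousOn_const
      asymptotics := fun ε hε => by
        refine ⟨2 * δ, by positivity, fun x hx => ?_⟩
        have hx0 : (‖x‖ : ℂ) ≠ 0 := by
          have : 0 < ‖x‖ := by linarith
          exact_mod_cast this.ne'
        rw [sphericalWave, step_of_ge ((le_div_iff₀ hδ).2 hx)]
        have : (‖x‖ : ℂ) * (((1 : ℝ) : ℂ) * phase (κ * ‖x‖) / ‖x‖) - phase (κ * ‖x‖) * 1 = 0 := by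
          push_cast; field_simp; ring
        rw [this, norm_zero]; exact hε.le }
  integrable := (continuous_sphericalSource κ hδ).integrable_of_hasCompactSupport
    (hasCompactSupport_sphericalSource κ hδ)
  weak := fun η hη hc => by
    have hg := contDiff_sphericalWave κ hδ
    have hη2 : ContDiff ℝ 2 η := hη.of_le (by norm_cast)
    simp only [← laplacian_sphericalWave κ hδ, add_mul, mul_add]
    rw [integral_add, integral_add, integral_laplacian_mul hg hη2 hc]
    · congr 1; congr 1; ext x; ring
    · exact (hg.continuous.mul (continuous_laplacian hη2)).integrable_of_hasCompactSupport
        (hasCompactSupport_laplacian hη2 hc).mul_left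
    · exact (hg.continuous.mul (continuous_const.mul hη.continuous)).integrable_of_hasCompactSupport
        (hc.mul_left.mul_left)
    · exact ((continuous_laplacian hg).mul hη.continuous).integrable_of_hasCompactSupport hc.mul_left
    · exact ((continuous_const.mul hg.continuous).mul hη.continuous).integrable_of_hasCompactSupport
        hc.mul_left

/-! ### The amplitude as a Fourier integral of the source. -/

lemma IsOutgoingSolution.comp_add {κ : ℝ} {u s F : Space3 → ℂ} (h : IsOutgoingSolution κ u s F)
    (y : Space3) : IsOutgoingSolution κ (fun x => u (x + y)) (fun x => s (x + y))
      fun n => F n * phase (κ * inner ℝ n y) where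
  farField := h.farField.comp_add y
  integrable := h.integrable.comp_add_right y
  weak := fun η hη hc => by
    have hη' : ContDiff ℝ ∞ fun x => η (x + -y) := hη.comp (contDiff_id.add contDiff_const)
    have := h.weak _ hη' (hc.comp_homeomorph (Homeomorph.addRight (-y)))
    rw [← integral_add_right_eq_self _ y, ← integral_add_right_eq_self (fun x => u x * _) y] at this
    simpa [laplacian_comp_add] using this

/-- Pairing an outgoing solution with a translated spherical wave. -/
lemma IsOutgoingSolution.integral_mul_sphericalWave {κ : ℝ} {u s F : Space3 → ℂ}
    (h : IsOutgoingSolution κ u s F) {δ : ℝ} (hδ : 0 < δ) (y : Space3) :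
    ∫ x, s x * sphericalWave κ δ (y - x) = ∫ z, u (y + z) * sphericalSource κ δ z := by
  have h1 := h.reciprocity ((isOutgoingSolution_sphericalWave κ hδ).comp_add (-y))
  have h2 : ∀ x, sphericalWave κ δ (x + -y) = sphericalWave κ δ (y - x) := fun x => by
    rw [← sub_eq_add_neg]; simp only [sphericalWave, norm_sub_rev]
  simp only [h2] at h1
  rw [h1, ← integral_add_right_eq_self _ y]
  simp [add_comm]

lemma norm_sphericalWave_le (κ δ : ℝ) (x : Space3) : ‖sphericalWave κ δ x‖ ≤ ‖x‖⁻¹ := by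
  rw [sphericalWave, norm_div, norm_mul, norm_phase, mul_one, Complex.norm_real, Complex.norm_real,
    norm_norm, ← one_div]
  gcongr
  rw [step, Real.norm_of_nonneg (Real.smoothTransition.nonneg _)]
  exact Real.smoothTransition.le_one _

lemma lintegral_inv_norm_unitBall_lt_top :
    ∫⁻ y in Metric.ball (0 : Space3) 1, ‖‖y‖⁻¹‖ₑ < ⊤ := by
  have h := integrableOn_fun_norm_addHaar (volume : Measure Space3) (f := fun r : ℝ => r⁻¹) (r := 1)
  have h2 : IntegrableOn (fun y : Space3 => ‖y‖⁻¹) (Metric.ball 0 1) := by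
    rw [h, finrank_euclideanSpace_fin]
    have : IntegrableOn (fun y : ℝ => y) (Set.Ioo 0 1) :=
      (continuous_id.integrableOn_Icc (a := 0) (b := 1)).mono_set Set.Ioo_subset_Icc_self
    refine this.congr_fun (fun y hy => ?_) measurableSet_Ioo
    have : y ≠ 0 := ne_of_gt hy.1
    simp only [smul_eq_mul]; field_simp
  exact h2.2

/-- The Newtonian potential of a bounded set of finite volume is bounded. -/
lemma exists_lintegral_inv_dist_le {B : Set Space3} (hB : volume B < ⊤) :
    ∃ C : ℝ≥0∞, C < ⊤ ∧ ∀ z : Space3, ∫⁻ y in B, ‖‖z - y‖⁻¹‖ₑ ≤ C := by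
  refine ⟨(∫⁻ y in Metric.ball (0 : Space3) 1, ‖‖y‖⁻¹‖ₑ) + volume B,
    ENNReal.add_lt_top.2 ⟨lintegral_inv_norm_unitBall_lt_top, hB⟩, fun z => ?_⟩
  have hm : Measurable fun y : Space3 => ‖‖z - y‖⁻¹‖ₑ := by fun_prop
  -- Within distance one of `z` the singularity is integrable with a value independent of `z`;
  -- elsewhere the kernel is at most `1`.
  have h1 : ∀ y, ‖‖z - y‖⁻¹‖ₑ ≤
      (Metric.ball z 1).indicator (fun y => ‖‖z - y‖⁻¹‖ₑ) y + 1 := fun y => by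
    by_cases hy : y ∈ Metric.ball z 1
    · rw [Set.indicator_of_mem hy]; exact le_self_add
    · rw [Set.indicator_of_notMem hy, zero_add]
      rw [Metric.mem_ball, not_lt, dist_comm, dist_eq_norm] at hy
      rw [← enorm_one (G := ℝ), enorm_le_iff_norm_le, norm_inv, norm_norm, norm_one]
      exact inv_le_one_of_one_le₀ hy
  calc ∫⁻ y in B, ‖‖z - y‖⁻¹‖ₑ
      ≤ ∫⁻ y in B, ((Metric.ball z 1).indicator (fun y => ‖‖z - y‖⁻¹‖ₑ) y + 1) :=
        lintegral_mono h1
    _ = (∫⁻ y in B, (Metric.ball z 1).indicator (fun y => ‖‖z - y‖⁻¹‖ₑ) y) + volume B := by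
        rw [lintegral_add_right _ measurable_const]; simp
    _ ≤ (∫⁻ y, (Metric.ball z 1).indicator (fun y => ‖‖z - y‖⁻¹‖ₑ) y) + volume B := by
        gcongr; exact Measure.restrict_le_self
    _ = _ := by
        congr 1
        rw [← lintegral_indicator measurableSet_ball,
          ← lintegral_sub_left_eq_self (fun y : Space3 =>
            (Metric.ball (0 : Space3) 1).indicator (fun y => ‖‖y‖⁻¹‖ₑ) y) z]
        congr 1; ext y
        by_cases hy : y ∈ Metric.ball z 1
        · rw [Set.indicator_of_mem hy, Set.indicator_of_mem]
          rw [Metric.mem_ball, dist_comm, dist_eq_norm] at hy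
          simpa using hy
        · rw [Set.indicator_of_notMem hy, Set.indicator_of_notMem]
          rw [Metric.mem_ball, dist_comm, dist_eq_norm] at hy
          simpa using hy

/-- Deviation, at scale `R`, of a spherical wave emitted at `R y` from a plane wave. -/
noncomputable def waveDefect (κ δ R : ℝ) (x y : Space3) : ℂ :=
  phase (-(κ * ‖R • y‖)) * (‖R • y‖ : ℂ) * sphericalWave κ δ (R • y - x) -
    phase (κ * inner ℝ (-(‖y‖⁻¹ • y)) x)

lemma measurable_waveDefect (κ δ R : ℝ) (hδ : 0 < δ) :
    Measurable fun p : Space3 × Space3 => waveDefect κ δ R p.1 p.2 := by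
  have hp := continuous_phase.measurable
  have hg := (contDiff_sphericalWave κ hδ).continuous.measurable
  unfold waveDefect
  have h1 : Measurable fun p : Space3 × Space3 => phase (-(κ * ‖R • p.2‖)) := hp.comp (by fun_prop)
  have h2 : Measurable fun p : Space3 × Space3 => sphericalWave κ δ (R • p.2 - p.1) :=
    hg.comp (by fun_prop)
  have h3 : Measurable fun p : Space3 × Space3 => phase (κ * inner ℝ (-(‖p.2‖⁻¹ • p.2)) p.1) := by
    refine hp.comp (measurable_const.mul (Measurable.inner ?_ measurable_fst))
    fun_prop
  have h4 : Measurable fun p : Space3 × Space3 => (‖R • p.2‖ : ℂ) :=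
    Complex.measurable_ofReal.comp (by fun_prop)
  exact ((h1.mul h4).mul h2).sub h3

variable {n₀ : Space3}

lemma norm_mem_of_mem_halfBall (hn : ‖n₀‖ = 1) {y : Space3} (hy : y ∈ Metric.ball n₀ (1 / 2)) :
    1 / 2 < ‖y‖ ∧ ‖y‖ < 2 := by
  rw [Metric.mem_ball, dist_eq_norm] at hy
  have h1 := norm_sub_norm_le n₀ y
  have h2 := norm_sub_norm_le y n₀
  rw [norm_sub_rev] at h1
  constructor <;> linarith

/-- At fixed `y` the defect may grow with `R` when `x` is close to `Ry`. By scaling it is at most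
`|y| / |x/R - y| + 1`, whose integral over the ball is bounded uniformly in `x` and `R`; this is the
domination needed for a source that is only integrable. -/
lemma exists_lintegral_waveDefect_le (κ δ : ℝ) (hn : ‖n₀‖ = 1) :
    ∃ C : ℝ≥0∞, C < ⊤ ∧ ∀ R > 0, ∀ x,
      ∫⁻ y in Metric.ball n₀ (1 / 2), ‖waveDefect κ δ R x y‖ₑ ≤ C := by
  obtain ⟨C, hC, H⟩ := exists_lintegral_inv_dist_le
    (B := Metric.ball n₀ (1 / 2)) measure_ball_lt_top
  refine ⟨2 * C + volume (Metric.ball n₀ (1 / 2)),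
    ENNReal.add_lt_top.2 ⟨ENNReal.mul_lt_top (by simp) hC, measure_ball_lt_top⟩, fun R hR x => ?_⟩
  have hpt : ∀ y ∈ Metric.ball n₀ (1 / 2), ‖waveDefect κ δ R x y‖ₑ ≤
      2 * ‖‖R⁻¹ • x - y‖⁻¹‖ₑ + 1 := fun y hy => by
    have hy2 := (norm_mem_of_mem_halfBall hn hy).2
    have e : R • y - x = R • -(R⁻¹ • x - y) := by
      rw [neg_sub, smul_sub, smul_smul, mul_inv_cancel₀ hR.ne', one_smul]
    have h1 : ‖waveDefect κ δ R x y‖ ≤ 2 * ‖R⁻¹ • x - y‖⁻¹ + 1 := by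
      refine (norm_sub_le _ _).trans ?_
      rw [norm_phase, norm_mul, norm_mul, norm_phase, one_mul, Complex.norm_real, norm_norm]
      refine add_le_add ?_ le_rfl
      refine (mul_le_mul_of_nonneg_left (norm_sphericalWave_le κ δ _)
        (norm_nonneg (R • y))).trans ?_
      rw [e, norm_smul R (-_), norm_neg, norm_smul, mul_inv]
      have hRn : ‖R‖ ≠ 0 := by simpa using hR.ne'
      calc _ = ‖y‖ * ‖R⁻¹ • x - y‖⁻¹ := by field_simp
        _ ≤ _ := by gcongr
    calc ‖waveDefect κ δ R x y‖ₑ ≤ ‖2 * ‖R⁻¹ • x - y‖⁻¹ + 1‖ₑ := by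
          rw [enorm_le_iff_norm_le]; exact h1.trans (le_abs_self _)
      _ ≤ ‖2 * ‖R⁻¹ • x - y‖⁻¹‖ₑ + ‖(1 : ℝ)‖ₑ := enorm_add_le _ _
      _ = _ := by
          rw [enorm_mul, enorm_one]
          congr 2
          rw [← ofReal_norm]; simp
  calc _ ≤ ∫⁻ y in Metric.ball n₀ (1 / 2), (2 * ‖‖R⁻¹ • x - y‖⁻¹‖ₑ + 1) :=
        lintegral_mono_ae (ae_restrict_of_forall_mem measurableSet_ball hpt)
    _ = 2 * (∫⁻ y in Metric.ball n₀ (1 / 2), ‖‖R⁻¹ • x - y‖⁻¹‖ₑ) +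
          volume (Metric.ball n₀ (1 / 2)) := by
        rw [lintegral_add_right _ measurable_const, lintegral_const_mul _ (by fun_prop)]; simp
    _ ≤ _ := by gcongr; exact H _

/-- For fixed `x` the convergence is uniform over the ball: there `|Ry| ≥ R/2`, so
`HasFarField.translate` applies to all `y` at once. -/
lemma tendsto_lintegral_waveDefect (κ δ : ℝ) (hδ : 0 < δ) (hn : ‖n₀‖ = 1) (x : Space3) :
    Tendsto (fun R : ℝ => ∫⁻ y in Metric.ball n₀ (1 / 2), ‖waveDefect κ δ R x y‖ₑ) atTop (𝓝 0) := by
  have hvol : volume (Metric.ball n₀ (1 / 2)) ≠ ⊤ := measure_ball_lt_top.ne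
  rw [ENNReal.tendsto_nhds_zero]
  intro ε hε
  obtain ⟨ε', hε', hle⟩ : ∃ ε' : NNReal, 0 < ε' ∧
      (ε' : ℝ≥0∞) * volume (Metric.ball n₀ (1 / 2)) ≤ ε := by
    obtain ⟨c, hc, h⟩ := ENNReal.exists_nnreal_pos_mul_lt hvol hε.ne'
    exact ⟨c, hc, h.le⟩
  obtain ⟨R₀, hR₀, H⟩ := (isOutgoingSolution_sphericalWave κ hδ).farField.translate ‖x‖
    (ε := ε') (by exact_mod_cast hε')
  filter_upwards [eventually_ge_atTop (2 * R₀)] with R hR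
  have hR0 : 0 < R := by linarith
  refine le_trans ?_ hle
  calc _ ≤ ∫⁻ _ in Metric.ball n₀ (1 / 2), (ε' : ℝ≥0∞) := by
        refine lintegral_mono_ae (ae_restrict_of_forall_mem measurableSet_ball fun y hy => ?_)
        have hy1 := (norm_mem_of_mem_halfBall hn hy).1
        have hnorm : ‖R • y‖ = R * ‖y‖ := by rw [norm_smul, Real.norm_of_nonneg hR0.le]
        have h1 := H (R • y) (by rw [hnorm]; nlinarith) (-x) (by rw [norm_neg])
        have hdir : ‖R • y‖⁻¹ • R • y = ‖y‖⁻¹ • y := by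
          rw [hnorm, smul_smul]; congr 1; field_simp
        rw [hdir, one_mul, inner_neg_right, ← inner_neg_left, ← sub_eq_add_neg] at h1
        have e : waveDefect κ δ R x y = phase (-(κ * ‖R • y‖)) *
            ((‖R • y‖ : ℂ) * sphericalWave κ δ (R • y - x) - phase (κ * ‖R • y‖) *
              phase (κ * inner ℝ (-(‖y‖⁻¹ • y)) x)) := by
          rw [waveDefect, mul_sub, ← mul_assoc, ← mul_assoc, phase_neg_mul, one_mul]
        have h2 : ‖waveDefect κ δ R x y‖ ≤ ε' := by
          rw [e, norm_mul, norm_phase, one_mul]; exact h1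
        rw [← ofReal_norm]
        exact ENNReal.ofReal_le_of_le_toReal (by simpa using h2)
    _ = _ := by simp

/-- The amplitude of an outgoing solution is determined by the Fourier transform of its source on
the sphere of radius `κ`: regularized form. -/
lemma IsOutgoingSolution.amplitude_mul_transform {κ : ℝ} {u s F : Space3 → ℂ}
    (h : IsOutgoingSolution κ u s F) {δ : ℝ} (hδ : 0 < δ) (hn : ‖n₀‖ = 1) :
    F n₀ * transform κ (sphericalSource κ δ) n₀ = transform κ s (-n₀) := by
  have hg := contDiff_sphericalWave κ hδ
  have hW := isOutgoingSolution_sphericalWave κ hδ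
  set T := transform κ (sphericalSource κ δ) with hT
  set S := transform κ s with hS
  set B := Metric.ball n₀ (1 / 2) with hB
  set P : Space3 → ℂ := fun y => F (‖y‖⁻¹ • y) * T (‖y‖⁻¹ • y) with hP
  set Q : Space3 → ℂ := fun y => S (-(‖y‖⁻¹ • y)) with hQ
  have hdirc : ContinuousOn (fun y : Space3 => ‖y‖⁻¹ • y) B := by
    refine ContinuousOn.smul (ContinuousOn.inv₀ continuous_norm.continuousOn fun y hy => ?_)
      continuousOn_id
    have := (norm_mem_of_mem_halfBall hn hy).1
    positivity
  have hPc : ContinuousOn P B :=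
    (h.farField.continuousOn.comp hdirc fun y hy =>
      dirn_mem (by linarith [(norm_mem_of_mem_halfBall hn hy).1])).mul
      ((continuous_transform κ hW.integrable).comp_continuousOn hdirc)
  have hQc : ContinuousOn Q B :=
    (continuous_transform κ h.integrable).comp_continuousOn hdirc.neg
  obtain ⟨C, hC, hCb⟩ := exists_lintegral_waveDefect_le κ δ hn
  set I : ℝ → ℝ≥0∞ := fun R => ∫⁻ x, ‖s x‖ₑ * ∫⁻ y in B, ‖waveDefect κ δ R x y‖ₑ with hI
  have hmeas : ∀ R, Measurable fun x => ∫⁻ y in B, ‖waveDefect κ δ R x y‖ₑ := fun R =>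
    (measurable_waveDefect κ δ R hδ).enorm.lintegral_prod_right'
  -- Dominated convergence in `x`, along a sequence of scales; the shift by one keeps every scale
  -- positive, as the uniform bound requires.
  have hIlim : Tendsto (fun n : ℕ => I ((n : ℝ) + 1)) atTop (𝓝 0) := by
    have hnat : Tendsto (fun n : ℕ => (n : ℝ) + 1) atTop atTop :=
      tendsto_atTop_add_const_right _ _ tendsto_natCast_atTop_atTop
    have := tendsto_lintegral_of_dominated_convergence' (μ := volume)
      (F := fun (n : ℕ) x => ‖s x‖ₑ * ∫⁻ y in B, ‖waveDefect κ δ ((n : ℝ) + 1) x y‖ₑ)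
      (f := fun _ => 0) (fun x => ‖s x‖ₑ * C)
      (fun n => h.integrable.aestronglyMeasurable.enorm.mul (hmeas _).aemeasurable)
      (fun n => ae_of_all _ fun x => mul_le_mul_right (hCb _ (by positivity) x) _)
      (by
        rw [lintegral_mul_const' _ _ hC.ne]
        exact (ENNReal.mul_lt_top h.integrable.2 hC).ne)
      (ae_of_all _ fun x => by
        have h1 := ENNReal.Tendsto.const_mul (a := ‖s x‖ₑ)
          ((tendsto_lintegral_waveDefect κ δ hδ hn x).comp hnat) (Or.inr enorm_ne_top)
        rwa [mul_zero] at h1)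
    simpa using this
  have hbound : ∀ ε : NNReal, 0 < ε → ∀ᶠ R : ℝ in atTop,
      ∫⁻ y in B, ‖P y - Q y‖ₑ ≤ ε * volume B + I R := by
    intro ε hε
    obtain ⟨R₀, hR₀, H⟩ := h.farField.average (continuous_sphericalSource κ hδ)
      (hasCompactSupport_sphericalSource κ hδ) (ε := ε) (by exact_mod_cast hε)
    filter_upwards [eventually_ge_atTop (2 * R₀)] with R hR
    have hR0 : 0 < R := by linarith
    have hpt : ∀ y ∈ B, ‖P y - Q y‖ₑ ≤ ε + ∫⁻ x, ‖s x‖ₑ * ‖waveDefect κ δ R x y‖ₑ := by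
      intro y hy
      have hy1 := (norm_mem_of_mem_halfBall hn hy).1
      have hnorm : ‖R • y‖ = R * ‖y‖ := by rw [norm_smul, Real.norm_of_nonneg hR0.le]
      have hdir : ‖R • y‖⁻¹ • R • y = ‖y‖⁻¹ • y := by
        rw [hnorm, smul_smul]; congr 1; field_simp
      have h1 := H (R • y) (by rw [hnorm]; nlinarith)
      -- Reciprocity enters here: the local average of `u` near `Ry`, with limit `P y` after
      -- normalization, is also a pairing of `s` with a distant spherical wave, whose limit is `Q
      -- y`.
      rw [hdir, ← h.integral_mul_sphericalWave hδ] at h1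
      set c : ℂ := phase (-(κ * ‖R • y‖)) with hc
      set Φ : ℂ := c * ((‖R • y‖ : ℂ) * ∫ x, s x * sphericalWave κ δ (R • y - x)) with hΦ
      have hTy : ∫ z, phase (κ * inner ℝ (‖y‖⁻¹ • y) z) * sphericalSource κ δ z =
          T (‖y‖⁻¹ • y) := by
        rw [hT, transform]; congr 1; ext z; ring
      rw [hTy] at h1
      have h2 : ‖Φ - P y‖ ≤ ε := by
        have e : Φ - P y = c * ((‖R • y‖ : ℂ) * (∫ x, s x * sphericalWave κ δ (R • y - x)) -
            phase (κ * ‖R • y‖) * (F (‖y‖⁻¹ • y) * T (‖y‖⁻¹ • y))) := by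
          rw [mul_sub, ← mul_assoc c (phase _), hc, phase_neg_mul, one_mul]
        rw [e, norm_mul, hc, norm_phase, one_mul]; exact h1
      have h3 : Φ - Q y = ∫ x, s x * waveDefect κ δ R x y := by
        obtain ⟨G, hG⟩ := hW.farField.exists_bound
        have i1 : Integrable fun x => s x * sphericalWave κ δ (R • y - x) :=
          h.integrable.mul_bdd (c := G)
            (hg.continuous.comp (continuous_const.sub continuous_id)).aestronglyMeasurable
            (ae_of_all _ fun x => hG _)
        have i2 : Integrable fun x => s x * phase (κ * inner ℝ (-(‖y‖⁻¹ • y)) x) :=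
          h.integrable.mul_bdd (c := 1)
            (contDiff_phase_inner κ _ (n := 0)).continuous.aestronglyMeasurable
            (ae_of_all _ fun x => (norm_phase _).le)
        rw [hΦ, hQ, hS]
        simp only [transform]
        rw [← integral_const_mul, ← integral_const_mul, ← integral_sub ((i1.const_mul _).const_mul _) i2]
        congr 1; ext x
        rw [waveDefect]; ring
      calc ‖P y - Q y‖ₑ = ‖-(Φ - P y) + (Φ - Q y)‖ₑ := by congr 1; ring
        _ ≤ ‖-(Φ - P y)‖ₑ + ‖Φ - Q y‖ₑ := enorm_add_le _ _
        _ ≤ _ := by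
          rw [enorm_neg]
          gcongr
          · rw [← ofReal_norm]
            exact ENNReal.ofReal_le_of_le_toReal (by simpa using h2)
          · rw [h3]
            refine (enorm_integral_le_lintegral_enorm _).trans (le_of_eq ?_)
            simp only [enorm_mul]
    calc ∫⁻ y in B, ‖P y - Q y‖ₑ
        ≤ ∫⁻ y in B, (ε + ∫⁻ x, ‖s x‖ₑ * ‖waveDefect κ δ R x y‖ₑ) :=
          lintegral_mono_ae (ae_restrict_of_forall_mem measurableSet_ball hpt)
      _ = ε * volume B + ∫⁻ y in B, ∫⁻ x, ‖s x‖ₑ * ‖waveDefect κ δ R x y‖ₑ := by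
          rw [lintegral_add_left measurable_const]; simp
      _ = ε * volume B + I R := by
          congr 1
          rw [hI, lintegral_lintegral_swap]
          · refine lintegral_congr fun x => ?_
            rw [lintegral_const_mul]
            exact ((measurable_waveDefect κ δ R hδ).comp
              (measurable_const.prodMk measurable_id)).enorm
          · refine AEMeasurable.mul (f := fun p : Space3 × Space3 => ‖s p.2‖ₑ)
              (g := fun p => ‖waveDefect κ δ R p.2 p.1‖ₑ) ?_ ?_
            · exact h.integrable.aestronglyMeasurable.enorm.comp_quasiMeasurePreserving
                Measure.quasiMeasurePreserving_snd
            · exact ((measurable_waveDefect κ δ R hδ).comp measurable_swap).enorm.aemeasurable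
  have hzero : ∫⁻ y in B, ‖P y - Q y‖ₑ = 0 := by
    have hvol : volume B ≠ ⊤ := measure_ball_lt_top.ne
    have h1 : ∀ ε : NNReal, 0 < ε → ∫⁻ y in B, ‖P y - Q y‖ₑ ≤ ε * volume B := by
      intro ε hε
      have hnat : Tendsto (fun n : ℕ => (n : ℝ) + 1) atTop atTop :=
        tendsto_atTop_add_const_right _ _ tendsto_natCast_atTop_atTop
      have l := hIlim.const_add (ε * volume B)
      rw [add_zero] at l
      exact ge_of_tendsto l (hnat.eventually (hbound ε hε))
    by_contra hne
    obtain ⟨c, hc, hlt⟩ := ENNReal.exists_nnreal_pos_mul_lt hvol hne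
    exact absurd (h1 c hc) (not_le.2 hlt)
  -- Averaging over `B` has given equality only almost everywhere; both sides are continuous on this
  -- open ball, so it holds at the centre `n₀`.
  have hae : P =ᵐ[volume.restrict B] Q := by
    have hm : AEMeasurable (fun y => ‖P y - Q y‖ₑ) (volume.restrict B) :=
      ((hPc.sub hQc).aestronglyMeasurable measurableSet_ball).enorm
    filter_upwards [(lintegral_eq_zero_iff' hm).1 hzero] with y hy
    simpa [sub_eq_zero] using hy
  have := Measure.eqOn_open_of_ae_eq hae Metric.isOpen_ball hPc hQc
    (Metric.mem_ball_self (by norm_num))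
  simpa [hP, hQ, hn] using this

/-- The amplitude of an outgoing solution is `-1/(4π)` times the Fourier transform of its source on
the sphere of radius `κ`. -/
theorem IsOutgoingSolution.amplitude_eq {κ : ℝ} {u s F : Space3 → ℂ}
    (h : IsOutgoingSolution κ u s F) {n₀ : Space3} (hn : ‖n₀‖ = 1) :
    -(4 * Real.pi : ℝ) * F n₀ = transform κ s (-n₀) := by
  have h1 := (tendsto_transform_sphericalSource κ n₀).const_mul (F n₀)
  have h2 : Tendsto (fun δ => F n₀ * transform κ (sphericalSource κ δ) n₀) (𝓝[>] 0)
      (𝓝 (transform κ s (-n₀))) := by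
    refine tendsto_const_nhds.congr' ?_
    filter_upwards [self_mem_nhdsWithin] with δ hδ using (h.amplitude_mul_transform hδ hn).symm
  rw [mul_comm]
  exact tendsto_nhds_unique h1 h2

/-! ### From scattering states to outgoing Helmholtz solutions. -/

/-- Extension by zero of a function on the celestial sphere. -/
noncomputable def extendSphere (F : CelestialSphere → ℂ) (x : Space3) : ℂ :=
  open Classical in if h : x ∈ Metric.sphere (0 : Space3) 1 then F ⟨x, h⟩ else 0

lemma extendSphere_coe (F : CelestialSphere → ℂ) (n : CelestialSphere) :
    extendSphere F n = F n := by
  rw [extendSphere, dif_pos n.2]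

/-- Continuity of the amplitude is not assumed: `F` is the uniform limit of the continuous functions
`e^{-iκr} r u(rn)`. The `O(r⁻²)` remainder, multiplied by `r`, still tends to zero. -/
lemma HasFarField.of_sphere {κ : ℝ} {u : Space3 → ℂ} (hu : Continuous u) {F : CelestialSphere → ℂ}
    {C r₀ : ℝ} (hr₀ : 0 < r₀) (H : ∀ r : ℝ, r₀ ≤ r → ∀ n : CelestialSphere,
      ‖u (r • (n : Space3)) - phase (κ * r) / (r : ℂ) * F n‖ ≤ C / r ^ 2) :
    HasFarField κ u (extendSphere F) := by
  have hmul : ∀ r : ℝ, r₀ ≤ r → ∀ n : CelestialSphere,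
      ‖(r : ℂ) * u (r • (n : Space3)) - phase (κ * r) * F n‖ ≤ C / r := by
    intro r hr n
    have hr0 : 0 < r := hr₀.trans_le hr
    have hrc : (r : ℂ) ≠ 0 := by exact_mod_cast hr0.ne'
    have e : (r : ℂ) * u (r • (n : Space3)) - phase (κ * r) * F n =
        r * (u (r • (n : Space3)) - phase (κ * r) / (r : ℂ) * F n) := by field_simp
    rw [e, norm_mul, Complex.norm_real, Real.norm_of_nonneg hr0.le]
    calc _ ≤ r * (C / r ^ 2) := by gcongr; exact H r hr n
      _ = C / r := by field_simp
  have hlim : Tendsto (fun r : ℝ => C / r) atTop (𝓝 0) := tendsto_const_nhds.div_atTop tendsto_id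
  refine ⟨hu, ?_, fun ε hε => ?_⟩
  · rw [continuousOn_iff_continuous_domRestrict]
    have e : (Metric.sphere (0 : Space3) 1).domRestrict (extendSphere F) = F :=
      funext fun n => extendSphere_coe F n
    rw [e]
    have hT : TendstoUniformly (fun (r : ℝ) (n : CelestialSphere) =>
        phase (-(κ * r)) * ((r : ℂ) * u (r • (n : Space3)))) F atTop := by
      rw [Metric.tendstoUniformly_iff]
      intro ε hε
      filter_upwards [hlim.eventually (gt_mem_nhds hε), eventually_ge_atTop r₀] with r h1 h2 n
      rw [dist_comm, dist_eq_norm]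
      have e : phase (-(κ * r)) * ((r : ℂ) * u (r • (n : Space3))) - F n =
          phase (-(κ * r)) * ((r : ℂ) * u (r • (n : Space3)) - phase (κ * r) * F n) := by
        rw [mul_sub, ← mul_assoc (phase _) (phase _), phase_neg_mul, one_mul]
      rw [e, norm_mul, norm_phase, one_mul]
      exact (hmul r h2 n).trans_lt h1
    refine hT.continuous (Eventually.of_forall fun r => ?_).frequently
    exact continuous_const.mul (continuous_const.mul (hu.comp (by fun_prop)))
  · obtain ⟨R, hR⟩ := ((hlim.eventually (gt_mem_nhds hε)).and (eventually_ge_atTop r₀)).exists_forall_of_atTop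
    refine ⟨max R r₀, by positivity, fun x hx => ?_⟩
    have hx0 : 0 < ‖x‖ := hr₀.trans_le ((le_max_right _ _).trans hx)
    have h1 := hmul ‖x‖ ((le_max_right _ _).trans hx) ⟨_, dirn_mem hx0⟩
    have h2 : ‖x‖ • (‖x‖⁻¹ • x) = x := by rw [smul_smul, mul_inv_cancel₀ hx0.ne', one_smul]
    simp only [h2] at h1
    have h3 := extendSphere_coe F ⟨_, dirn_mem hx0⟩
    simp only at h3
    rw [h3]
    exact h1.trans (hR _ ((le_max_left _ _).trans hx)).1.le

lemma planeWave_eq (k : Space3) : planeWave k = fun x => phase (1 * inner ℝ k x) := by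
  ext x; simp [planeWave, phase]

lemma norm_planeWave (k x : Space3) : ‖planeWave k x‖ = 1 := by
  rw [planeWave_eq]; exact norm_phase _

lemma continuous_planeWave (k : Space3) : Continuous (planeWave k) := by
  rw [planeWave_eq]; exact (contDiff_phase_inner 1 k (n := 0)).continuous

lemma laplacian_planeWave (k x : Space3) :
    (Δ (planeWave k)) x = -(‖k‖ : ℂ) ^ 2 * planeWave k x := by
  rw [planeWave_eq, laplacian_eq (contDiff_phase_inner 1 k)]
  simp only [fderiv_phase_inner]
  have h : ∀ i, fderiv ℝ (fun y => Complex.I * ((1 * inner ℝ k (basisVec i) : ℝ) : ℂ) *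
      phase (1 * inner ℝ k y)) x (basisVec i) =
      -((((k i) ^ 2 : ℝ)) : ℂ) * phase (1 * inner ℝ k x) := fun i => by
    rw [fderiv_const_mul (((contDiff_phase_inner 1 k (n := 1)).differentiable (by norm_num)) x),
      smul_apply, fderiv_phase_inner, inner_basisVec]
    simp only [smul_eq_mul, one_mul]
    push_cast
    linear_combination (k i : ℂ) ^ 2 * phase (inner ℝ k x) * Complex.I_sq
  simp only [h]
  rw [← Finset.sum_mul, Finset.sum_neg_distrib, ← Complex.ofReal_sum,
    ← EuclideanSpace.real_norm_sq_eq]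
  push_cast; rfl

lemma isWeakHelmholtz_planeWave (k : Space3) : IsWeakHelmholtz ‖k‖ (planeWave k) 0 := by
  intro η hη hc
  have hη2 : ContDiff ℝ 2 η := hη.of_le (by norm_cast)
  have hp : ContDiff ℝ 2 (planeWave k) := by rw [planeWave_eq]; exact contDiff_phase_inner 1 k
  have h := integral_laplacian_mul hp hη2 hc
  simp only [mul_add]
  rw [integral_add, ← h, ← integral_add]
  · simp only [laplacian_planeWave]
    symm
    simp only [Pi.zero_apply, zero_mul, integral_zero]
    refine integral_eq_zero_of_ae (ae_of_all _ fun x => ?_)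
    simp only [Pi.zero_apply]; ring
  · exact ((continuous_laplacian hp).mul hη.continuous).integrable_of_hasCompactSupport hc.mul_left
  · exact (hp.continuous.mul (continuous_const.mul hη.continuous)).integrable_of_hasCompactSupport
      (hc.mul_left.mul_left)
  · exact (hp.continuous.mul (continuous_laplacian hη2)).integrable_of_hasCompactSupport
      (hasCompactSupport_laplacian hη2 hc).mul_left
  · exact (hp.continuous.mul (continuous_const.mul hη.continuous)).integrable_of_hasCompactSupport
      (hc.mul_left.mul_left)

lemma integrable_mul_of_locallyIntegrable {s η : Space3 → ℂ} (hs : LocallyIntegrable s)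
    (hη : Continuous η) (hc : HasCompactSupport η) : Integrable fun x => s x * η x := by
  have := hs.integrable_smul_right_of_hasCompactSupport hη hc
  simpa using this

lemma IsWeakHelmholtz.sub {κ : ℝ} {u v s t : Space3 → ℂ} (hu : IsWeakHelmholtz κ u s)
    (hv : IsWeakHelmholtz κ v t) (huc : Continuous u) (hvc : Continuous v)
    (hs : LocallyIntegrable s) (ht : LocallyIntegrable t) :
    IsWeakHelmholtz κ (fun x => u x - v x) fun x => s x - t x := by
  intro η hη hc
  have hη2 : ContDiff ℝ 2 η := hη.of_le (by norm_cast)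
  have hθ : Continuous fun x => (Δ η) x + (κ : ℂ) ^ 2 * η x :=
    (continuous_laplacian hη2).add (continuous_const.mul hη.continuous)
  have hθc : HasCompactSupport fun x => (Δ η) x + (κ : ℂ) ^ 2 * η x :=
    (hasCompactSupport_laplacian hη2 hc).add hc.mul_left
  simp only [sub_mul]
  rw [integral_sub (integrable_mul_of_locallyIntegrable hs hη.continuous hc)
      (integrable_mul_of_locallyIntegrable ht hη.continuous hc),
    integral_sub (integrable_mul_of_locallyIntegrable huc.locallyIntegrable hθ hθc)
      (integrable_mul_of_locallyIntegrable hvc.locallyIntegrable hθ hθc), hu η hη hc, hv η hη hc]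

section potential
variable {V : Space3 → ℝ}

lemma locallyIntegrable_potential (hV : IsShortRange V) : LocallyIntegrable V := by
  rw [locallyIntegrable_iff]
  intro K hK
  have : IsFiniteMeasure (volume.restrict K) := ⟨by simpa using hK.measure_lt_top⟩
  exact (hV.locally_sq_integrable K hK).integrable (by norm_num)

/-- Local integrability comes from local square-integrability; at infinity the exponential is
dominated by `(1 + |x|)⁻⁴`, integrable since `4 > 3`. -/
lemma integrable_potential (hV : IsShortRange V) : Integrable V := by
  obtain ⟨a, ha, hO⟩ := hV.exp_decay
  rw [Metric.cobounded_eq_cocompact] at hO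
  have hexp : (fun x : Space3 => Real.exp (-‖x‖ / a)) =O[cocompact Space3]
      fun x : Space3 => (1 + ‖x‖) ^ (-(4 : ℝ)) := by
    have h1 : Tendsto (fun x : Space3 => 1 + ‖x‖) (cocompact Space3) atTop :=
      tendsto_atTop_add_const_left _ _ (tendsto_norm_cocompact_atTop)
    have h2 := (isLittleO_exp_neg_mul_rpow_atTop (inv_pos.2 ha) (-4)).isBigO.comp_tendsto h1
    refine Asymptotics.IsBigO.trans ?_ h2
    refine Asymptotics.IsBigO.of_bound (Real.exp a⁻¹) (Eventually.of_forall fun x => ?_)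
    simp only [Function.comp, Real.norm_eq_abs, Real.abs_exp]
    rw [← Real.exp_add]
    refine le_of_eq (congrArg _ ?_)
    field_simp; ring
  refine (locallyIntegrable_potential hV).integrable_of_isBigO_cocompact
    (hO.trans hexp) ?_
  exact (integrable_one_add_norm (by rw [finrank_euclideanSpace_fin]; norm_num)).integrableAtFilter _

lemma locallyIntegrable_potential_mul (hV : IsShortRange V) {u : Space3 → ℂ} (hu : Continuous u) :
    LocallyIntegrable fun x => (V x : ℂ) * u x := by
  have h : LocallyIntegrable fun x => (V x : ℂ) := by
    intro x
    obtain ⟨s, hs, hi⟩ := locallyIntegrable_potential hV x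
    exact ⟨s, hs, hi.ofReal⟩
  rw [locallyIntegrable_iff] at h ⊢
  exact fun K hK => (h K hK).mul_continuousOn hu.continuousOn hK

/-- Multiply by `2M`, use `2ME = |k|²`, and move the potential term into the source. Continuity of
`u` makes `Vu` locally integrable, so the integrals may be split. -/
lemma isWeakHelmholtz_of_schrodinger {M : ℝ} (hM : 0 < M) (hV : IsShortRange V) {k : Space3}
    {u g : Space3 → ℂ} (hu : Continuous u)
    (h : IsSchrodingerViolation M V (kineticEnergy M k) u g) :
    IsWeakHelmholtz ‖k‖ u fun x => 2 * M * (g x + V x * u x) := by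
  intro η hη hc
  have hMc : (M : ℂ) ≠ 0 := by exact_mod_cast hM.ne'
  have hη2 : ContDiff ℝ 2 η := hη.of_le (by norm_cast)
  have hVu := integrable_mul_of_locallyIntegrable (locallyIntegrable_potential_mul hV hu)
    hη.continuous hc
  have hgη := integrable_mul_of_locallyIntegrable h.1 hη.continuous hc
  have hθ : Continuous fun x => (Δ η) x + (‖k‖ : ℂ) ^ 2 * η x :=
    (continuous_laplacian hη2).add (continuous_const.mul hη.continuous)
  have hθc : HasCompactSupport fun x => (Δ η) x + (‖k‖ : ℂ) ^ 2 * η x :=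
    (hasCompactSupport_laplacian hη2 hc).add hc.mul_left
  have huθ := integrable_mul_of_locallyIntegrable hu.locallyIntegrable hθ hθc
  have e : ∀ x, u x * ((kineticEnergy M k : ℂ) * η x + (Δ η) x / (2 * (M : ℂ)) - (V x : ℂ) * η x) =
      (2 * M : ℂ)⁻¹ * (u x * ((Δ η) x + (‖k‖ : ℂ) ^ 2 * η x)) - V x * u x * η x := fun x => by
    rw [kineticEnergy]; push_cast; field_simp; ring
  have h2 := h.2 η hη hc
  simp only [e] at h2
  rw [integral_sub (huθ.const_mul _) hVu, integral_const_mul] at h2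
  have e2 : ∀ x, 2 * M * (g x + V x * u x) * η x =
      2 * M * (g x * η x) + 2 * M * (V x * u x * η x) := fun x => by ring
  simp only [e2]
  rw [integral_add (hgη.const_mul _) (hVu.const_mul _), integral_const_mul, integral_const_mul, h2]
  field_simp
  ring

end potential

/-- The common plane wave, which is not an outgoing far field, cancels in the difference. -/
lemma _root_.HasScatteringForm.hasFarField_sub {k : Space3} {ψ ψ' : Space3 → ℂ}
    {f f' : CelestialSphere → ℂ} (h : HasScatteringForm k ψ f) (h' : HasScatteringForm k ψ' f') :
    HasFarField ‖k‖ (fun x => ψ x - ψ' x) (extendSphere fun n => f n - f' n) := by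
  obtain ⟨C, r₀, hr₀, H⟩ := h.asymptotics
  obtain ⟨C', r₀', hr₀', H'⟩ := h'.asymptotics
  refine HasFarField.of_sphere (u := fun x => ψ x - ψ' x) (C := C + C') (r₀ := max r₀ r₀') (h.continuous.sub h'.continuous)
    (by positivity) fun r hr n => ?_
  have h1 := H r ((le_max_left _ _).trans hr) n
  have h2 := H' r ((le_max_right _ _).trans hr) n
  set z := r • (n : Space3)
  rw [phase, add_div]
  refine le_trans (le_of_eq (congrArg _ ?_)) ((norm_sub_le _ _).trans (add_le_add h1 h2))
  ring

lemma _root_.HasScatteringForm.hasFarField_sub_planeWave {k : Space3} {ψ : Space3 → ℂ}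
    {f : CelestialSphere → ℂ} (h : HasScatteringForm k ψ f) :
    HasFarField ‖k‖ (fun x => ψ x - planeWave k x) (extendSphere f) := by
  obtain ⟨C, r₀, hr₀, H⟩ := h.asymptotics
  exact HasFarField.of_sphere (h.continuous.sub (continuous_planeWave k)) hr₀ H

lemma _root_.HasScatteringForm.exists_bound {k : Space3} {ψ : Space3 → ℂ} {f : CelestialSphere → ℂ}
    (h : HasScatteringForm k ψ f) : ∃ B, ∀ x, ‖ψ x‖ ≤ B := by
  obtain ⟨B, hB⟩ := h.hasFarField_sub_planeWave.exists_bound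
  refine ⟨B + 1, fun x => ?_⟩
  have := norm_add_le (ψ x - planeWave k x) (planeWave k x)
  rw [sub_add_cancel, norm_planeWave] at this
  linarith [hB x]

/-- Needed because `0 * ⊤ = 0` in `ℝ≥0∞`. A vanishing state would force the plane wave, of modulus
one, to be balanced by a term decaying like `1/r`. -/
lemma _root_.HasScatteringForm.supNorm_ne_zero {k : Space3} {ψ : Space3 → ℂ} {f : CelestialSphere → ℂ}
    (h : HasScatteringForm k ψ f) : supNorm ψ ≠ 0 := by
  intro h0
  have hψ : ∀ x, ψ x = 0 := fun x => by
    have : ‖ψ x‖ₑ ≤ supNorm ψ := le_iSup (fun x => ‖ψ x‖ₑ) x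
    rw [h0] at this
    simpa using this
  obtain ⟨B, -, hB⟩ := h.hasFarField_sub_planeWave.exists_amplitude_bound
  obtain ⟨R, hR, H⟩ := h.hasFarField_sub_planeWave.asymptotics 1 one_pos
  set r := max R (B + 2) with hr
  have hr0 : 0 < r := hR.trans_le (le_max_left _ _)
  have hx : ‖r • basisVec 0‖ = r := by
    rw [norm_smul, norm_basisVec, mul_one, Real.norm_of_nonneg hr0.le]
  have h1 := H (r • basisVec 0) (by rw [hx]; exact le_max_left _ _)
  have h2 := hB _ (dirn_mem (x := r • basisVec 0) (by rw [hx]; exact hr0))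
  rw [hψ, zero_sub, hx] at h1
  rw [hx] at h2
  set P := phase (‖k‖ * r) * extendSphere f (r⁻¹ • r • basisVec 0) with hP
  have h3 : ‖P‖ ≤ B := by rw [hP, norm_mul, norm_phase, one_mul]; exact h2
  have h4 : ‖(r : ℂ) * -planeWave k (r • basisVec 0)‖ = r := by
    rw [norm_mul, norm_neg, norm_planeWave, mul_one, Complex.norm_real, Real.norm_of_nonneg hr0.le]
  have h5 := norm_sub_norm_le ((r : ℂ) * -planeWave k (r • basisVec 0)) P
  rw [h4] at h5
  have h6 : B + 2 ≤ r := le_max_right _ _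
  linarith

/-! ### The amplitude error and its bound. -/

variable {M : ℝ} {V : Space3 → ℝ} {k p : Space3} {ψ ψt ξ g : Space3 → ℂ}
  {f ft h : CelestialSphere → ℂ}

/-- The amplitude error is the pairing of the violation with the exact state of ingoing momentum
`-p`. -/
lemma amplitude_error_eq (hM : 0 < M) (hV : IsShortRange V) (hψ : IsExactScatteringState M V k ψ f)
    (hψt : HasScatteringForm k ψt ft) (hg : IsSchrodingerViolation M V (kineticEnergy M k) ψt g)
    (hgi : Integrable g) (hp : ‖p‖ = ‖k‖) (n : CelestialSphere) (hn : ‖k‖ • (n : Space3) = p)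
    (hξ : IsExactScatteringState M V (-p) ξ h) :
    -(4 * Real.pi : ℝ) * (ft n - f n) = 2 * M * ∫ x, g x * ξ x := by
  have hVi := (integrable_potential hV).ofReal (𝕜 := ℂ)
  have hκ : ‖-p‖ = ‖k‖ := by rw [norm_neg, hp]
  set χ : Space3 → ℂ := fun x => ψt x - ψ x with hχ
  set s : Space3 → ℂ := fun x => 2 * M * (g x + V x * χ x) with hs
  set t : Space3 → ℂ := fun x => 2 * M * (V x * ξ x) with ht
  have hχF : HasFarField ‖k‖ χ _ := hψt.hasFarField_sub hψ.form
  obtain ⟨Bχ, hBχ⟩ := hχF.exists_bound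
  obtain ⟨Bξ, hBξ⟩ := hξ.form.exists_bound
  have hξc := hξ.form.continuous
  have hVχ : Integrable fun x => (V x : ℂ) * χ x :=
    hVi.mul_bdd hχF.continuous.aestronglyMeasurable (ae_of_all _ hBχ)
  have hVξ : Integrable fun x => (V x : ℂ) * ξ x :=
    hVi.mul_bdd hξc.aestronglyMeasurable (ae_of_all _ hBξ)
  have loc : ∀ {u w : Space3 → ℂ}, LocallyIntegrable w → Continuous u →
      LocallyIntegrable fun x => 2 * M * (w x + V x * u x) := fun hw hu =>
    (hw.add (locallyIntegrable_potential_mul hV hu)).smul (2 * M : ℂ)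
  have h0 : LocallyIntegrable (0 : Space3 → ℂ) := locallyIntegrable_zero
  have hsol : IsOutgoingSolution ‖k‖ χ s (extendSphere fun n => ft n - f n) := by
    refine ⟨hχF, (hgi.add hVχ).const_mul _, ?_⟩
    have := (isWeakHelmholtz_of_schrodinger hM hV hψt.continuous hg).sub
      (isWeakHelmholtz_of_schrodinger hM hV hψ.form.continuous hψ.eigenstate)
      hψt.continuous hψ.form.continuous (loc hg.1 hψt.continuous) (loc h0 hψ.form.continuous)
    convert this using 2 with x
    simp only [hs, hχ, Pi.zero_apply]; ring
  have hsol' : IsOutgoingSolution ‖k‖ (fun x => ξ x - planeWave (-p) x) t (extendSphere h) := by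
    rw [← hκ]
    refine ⟨hξ.form.hasFarField_sub_planeWave, hVξ.const_mul _, ?_⟩
    have := (isWeakHelmholtz_of_schrodinger hM hV hξc hξ.eigenstate).sub
      (isWeakHelmholtz_planeWave (-p)) hξc (continuous_planeWave _) (loc h0 hξc) h0
    convert this using 2 with x
    simp only [ht, Pi.zero_apply]; ring
  have hrec := hsol.reciprocity hsol'
  have hn1 : ‖(n : Space3)‖ = 1 := by simp
  have hamp := hsol.amplitude_eq hn1
  rw [extendSphere_coe] at hamp
  rw [hamp]
  -- As `|k| n = p`, the Fourier kernel of the amplitude formula is exactly the ingoing wave of `ξ`.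
  have hpw : ∀ x, phase (‖k‖ * inner ℝ (-(n : Space3)) x) = planeWave (-p) x := fun x => by
    simp only [planeWave_eq]
    rw [← hn, one_mul, inner_neg_left, inner_neg_left, real_inner_smul_left,
      mul_neg]
  simp only [transform, hpw]
  have is : Integrable s := hsol.integrable
  have i1 : Integrable fun x => s x * ξ x :=
    is.mul_bdd hξc.aestronglyMeasurable (ae_of_all _ hBξ)
  have i2 : Integrable fun x => s x * planeWave (-p) x :=
    is.mul_bdd (continuous_planeWave _).aestronglyMeasurable
      (ae_of_all _ fun x => (norm_planeWave _ x).le)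
  have i3 : Integrable fun x => χ x * t x :=
    (hVξ.const_mul _).bdd_mul hχF.continuous.aestronglyMeasurable (ae_of_all _ hBχ)
  simp only [mul_sub] at hrec
  rw [integral_sub i1 i2] at hrec
  rw [← integral_const_mul]
  -- The contributions `2M V χ ξ` of the two sources cancel.
  have e : ∫ x, 2 * M * (g x * ξ x) = (∫ x, s x * ξ x) - ∫ x, χ x * t x := by
    rw [← integral_sub i1 i3]
    congr 1; ext x
    simp only [hs, ht]; ring
  rw [e, ← hrec]; ring

/-- Hölder's inequality applied to `amplitude_error_eq`, which gives `M/(2π)`; the stated constant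
is twice that. If `g` is not integrable the right side is infinite. -/
lemma amplitude_error_le (hM : 0 < M) (hV : IsShortRange V)
    (hψ : IsExactScatteringState M V k ψ f)
    (hψt : HasScatteringForm k ψt ft) (hg : IsSchrodingerViolation M V (kineticEnergy M k) ψt g)
    (hp : ‖p‖ = ‖k‖) (n : CelestialSphere) (hn : ‖k‖ • (n : Space3) = p)
    (hξ : IsExactScatteringState M V (-p) ξ h) :
    ‖ft n - f n‖ₑ ≤ ENNReal.ofReal (M / Real.pi) * supNorm ξ * lOneNorm g := by
  have hpi := Real.pi_pos
  by_cases htop : lOneNorm g = ⊤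
  · rw [htop, ENNReal.mul_top]
    · exact le_top
    · exact mul_ne_zero (by simpa using div_pos hM hpi)
        hξ.form.supNorm_ne_zero
  have hgi : Integrable g := ⟨hg.1.aestronglyMeasurable, lt_top_iff_ne_top.2 htop⟩
  have key := amplitude_error_eq hM hV hψ hψt hg hgi hp n hn hξ
  have e : ft n - f n = ((-(M / (2 * Real.pi)) : ℝ) : ℂ) * ∫ x, g x * ξ x := by
    have hpc : (Real.pi : ℂ) ≠ 0 := by exact_mod_cast hpi.ne'
    push_cast at key ⊢
    field_simp
    linear_combination (-1 / 2 : ℂ) * key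
  rw [e, enorm_mul, mul_assoc]
  gcongr
  · rw [← ofReal_norm, Complex.norm_real, norm_neg, Real.norm_of_nonneg (by positivity)]
    apply ENNReal.ofReal_le_ofReal
    gcongr
    linarith
  · calc _ ≤ ∫⁻ x, ‖g x * ξ x‖ₑ := enorm_integral_le_lintegral_enorm _
      _ ≤ ∫⁻ x, supNorm ξ * ‖g x‖ₑ := by
          refine lintegral_mono fun x => ?_
          rw [enorm_mul, mul_comm]
          gcongr
          exact le_iSup (fun x => ‖ξ x‖ₑ) x
      _ = _ := by
          rw [lintegral_const_mul'' _ hgi.aestronglyMeasurable.enorm]; rfl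

/-- Exact scattering states of a spherically symmetric potential can be rotated. -/
lemma _root_.IsExactScatteringState.comp_isometry (hV : ∀ x y : Space3, ‖x‖ = ‖y‖ → V x = V y)
    (hψ : IsExactScatteringState M V k ψ f) (A : Space3 ≃ₗᵢ[ℝ] Space3) :
    IsExactScatteringState M V (A.symm k) (fun x => ψ (A x))
      fun n => f ⟨A n, by simp⟩ where
  form :=
    { continuous := hψ.form.continuous.comp A.continuous
      asymptotics := by
        obtain ⟨C, r₀, hr₀, H⟩ := hψ.form.asymptotics
        refine ⟨C, r₀, hr₀, fun r hr n => ?_⟩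
        have h1 := H r hr ⟨A n, by simp⟩
        have h2 : planeWave (A.symm k) (r • (n : Space3)) = planeWave k (r • A n) := by
          rw [planeWave, planeWave, ← map_smul, ← A.inner_map_map, A.apply_symm_apply]
        rw [h2, map_smul, A.symm.norm_map]
        exact h1 }
  eigenstate := by
    refine ⟨locallyIntegrable_zero, fun η hη hc => ?_⟩
    have hη' : ContDiff ℝ ∞ fun x => η (A.symm x) := hη.comp A.symm.contDiff
    have hc' : HasCompactSupport fun x => η (A.symm x) := hc.comp_homeomorph A.symm.toHomeomorph
    have hE : kineticEnergy M (A.symm k) = kineticEnergy M k := by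
      rw [kineticEnergy, kineticEnergy, A.symm.norm_map]
    have h1 := hψ.eigenstate.2 _ hη' hc'
    have hΔ : ∀ x, (Δ fun x => η (A.symm x)) x = (Δ η) (A.symm x) := fun x => by
      simpa using laplacian_comp_isometry_add (u := η) A.symm 0 x
    simp only [hΔ, Pi.zero_apply, zero_mul, integral_zero] at h1
    -- The equation for `ψ` was tested against `η ∘ A⁻¹`; changing variables by `A` moves the
    -- rotation onto `ψ`, and symmetry leaves `V` unchanged.
    rw [← A.measurePreserving.integral_comp A.toHomeomorph.measurableEmbedding] at h1
    simp only [A.symm_apply_apply, hV _ _ (A.norm_map _)] at h1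
    rw [hE]
    simpa using h1

lemma supNorm_comp_isometry (A : Space3 ≃ₗᵢ[ℝ] Space3) (ψ : Space3 → ℂ) :
    supNorm (fun x => ψ (A x)) = supNorm ψ :=
  A.toEquiv.iSup_comp (g := fun x => ‖ψ x‖ₑ)

end Scattering

theorem mainTheorem6
    (M : ℝ) (hM : 0 < M) (V : Space3 → ℝ) (hV : IsShortRange V)
    (k : Space3) (hk : k ≠ 0)
    (ψ : Space3 → ℂ) (f : CelestialSphere → ℂ) (hψ : IsExactScatteringState M V k ψ f)
    (ψt : Space3 → ℂ) (ft : CelestialSphere → ℂ) (hψt : HasScatteringForm k ψt ft)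
    (g : Space3 → ℂ) (hg : IsSchrodingerViolation M V (kineticEnergy M k) ψt g)
    (p : Space3) (hp : ‖p‖ = ‖k‖)
    (n : CelestialSphere) (hn : (n : Space3) = ‖p‖⁻¹ • p) :
    (∀ (ξ : Space3 → ℂ) (h : CelestialSphere → ℂ), IsExactScatteringState M V (-p) ξ h →
      ‖ft n - f n‖ₑ ≤ ENNReal.ofReal (M / Real.pi) * supNorm ξ * lOneNorm g) ∧
    ((∀ x y : Space3, ‖x‖ = ‖y‖ → V x = V y) →
      ‖ft n - f n‖ₑ ≤ ENNReal.ofReal (M / Real.pi) * supNorm ψ * lOneNorm g) := by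
  have hk0 : ‖k‖ ≠ 0 := norm_ne_zero_iff.2 hk
  have hn' : ‖k‖ • (n : Space3) = p := by
    rw [hn, hp, smul_smul, mul_inv_cancel₀ hk0, one_smul]
  refine ⟨fun ξ h hξ => Scattering.amplitude_error_le hM hV hψ hψt hg hp n hn' hξ,
    fun hsym => ?_⟩
  -- Reflection in the plane orthogonal to `k + p` exchanges `k` and `-p`, as these have equal
  -- length; if `k = -p` it is the identity.
  set A := (Submodule.reflection (Submodule.span ℝ {k - -p})ᗮ) with hA
  have hAk : A.symm k = -p := by
    rw [hA, Submodule.reflection_symm]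
    exact Submodule.reflection_sub (by rw [norm_neg, hp])
  have hξ := hψ.comp_isometry hsym A
  rw [hAk] at hξ
  have := Scattering.amplitude_error_le hM hV hψ hψt hg hp n hn' hξ
  rwa [Scattering.supNorm_comp_isometry] at this
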